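/- Let $(R,\mathfrak m)$ be a Noetherian local ring with infinite residue field, let $M$ be a finitely generated $R$-module with $\dim M = 2$ and $\operatorname{depth} M > 0$, let $\mathfrak q$ be an $\mathfrak m$-primary ideal, and let $\mathbb M = \{M_n\}_{n\ge 0}$ be a good $\mathfrak q$-filtration of $M$, i.e. $M = M_0 \supseteq M_1 \supseteq \cdots$ are submodules with $\mathfrak q M_n \subseteq M_{n+1}$ for all $n$ and $\mathfrak q M_n = M_{n+1}$ for all large $n$. An element $a \in \mathfrak q$ is *$\mathbb M$-superficial for $\mathfrak q$* if there is $c \ge 0$ with $(M_{n+1} :_M a) \cap M_c = M_n$ for all $n \ge c$; a sequence $a_1, a_2$ is $\mathbb M$-superficial for $\mathfrak q$ if $a_1$ is, and $a_2$ is superficial for $\mathfrak q$ with respect to the induced filtration $\{(M_n + a_1M)/a_1M\}$ of $M/a_1M$. Let $J = (a_1, a_2)$ be generated by an $\mathbb M$-superficial sequence $a_1, a_2$ for $\mathfrak q$, and let $\mathbb N = \{J^n M\}_{n \ge 0}$ be the $J$-adic filtration of $M$. Write $\lambda$ for length. For $\mathbb F = \{F_n\} \in \{\mathbb M, \mathbb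 N\}$ write $\sum_{n \ge 0} \lambda(F_n/F_{n+1})\, t^n = h_{\mathbb F}(t)/(1-t)^2$ with $h_{\mathbb F} \in \mathbb Z[t]$, and set $e_2(\mathbb F) = h_{\mathbb F}''(1)/2$. Then $h_{\mathbb M}$ and $h_{\mathbb N}$ exist, the sum $\sum_{n\ge1} n\,\lambda(M_{n+1}/JM_n)$ is finite, and $$e_2(\mathbb M) - e_2(\mathbb N) \;\le\; \sum_{n \ge 1} n\,\lambda\big(M_{n+1}/JM_n\big) \;+\; \sum_{n \ge 1} \lambda\big((J^{n+1}M :_M a_1)/J^nM\big),$$ where the second sum is taken in $\mathbb N \cup \{\infty\}$. If $a_1, a_2$ is moreover an $\mathbb N$-superficial sequence for $J$, then the second sum is finite, and it is $0$ as soon as the associated graded module $gr_{\mathbb N}(M) = \bigoplus_{n \ge 0} J^nM/J^{n+1}M$ (over $gr_J(R)$, with respect to the homogeneous maximal ideal) has positive depth. In particular, if $\operatorname{depth} gr_{\mathbb N}(M) > 0$ (with no $\mathbb N$-superficiality assumed), then $$e_2(\mathbb M) - e_2(\mathbb N) \;\le\; \sum_{n \ge 1} n\,\lambda\big(M_{n+1}/JM_n\big).$$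 -/

import Mathlib

open Polynomial

/-- The depth of an `A`-module `N` with respect to an ideal `I` of `A`: the supremum of the lengths
of the (weakly) `N`-regular sequences whose entries lie in `I`. For a finitely generated module
over a Noetherian ring with `N ≠ I N` a weakly regular sequence in `I` is the same as a regular
sequence. -/
noncomputable def Ideal.depth {A : Type*} [CommRing A] (I : Ideal A)
    (N : Type*) [AddCommGroup N] [Module A N] : ℕ∞ :=
  ⨆ (rs : List A) (_ : (∀ r ∈ rs, r ∈ I) ∧ RingTheory.Sequence.IsWeaklyRegular N rs),
    (rs.length : ℕ∞)

namespace Submodule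

variable {R M : Type*} [CommRing R] [AddCommGroup M] [Module R M]

/-- The length `λ(A / B)` of the quotient of `A` by `B`, for submodules `B ≤ A` of `M`. -/
noncomputable def relLength (A B : Submodule R M) : ℕ∞ :=
  Module.length R (A ⧸ B.submoduleOf A)

/-- The submodule `(B :_M a) = {x ∈ M | a x ∈ B}`. -/
def colonElem (B : Submodule R M) (a : R) : Submodule R M :=
  B.comap (LinearMap.lsmul R M a)

end Submodule

/-- The dimension of a module (the Krull dimension of its support) as a natural number; used only
when that dimension is finite and the module is nonzero. -/
noncomputable def Module.natDim (R M : Type*) [CommRing R] [AddCommGroup M] [Module R M] : ℕ :=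
  ((Module.supportDim R M).unbotD 0).toNat

namespace Ideal

/-- The ideal `⨁ Iⁱ⁺¹ tⁱ` of the Rees algebra `⨁ Iⁱ tⁱ`. -/
def grKernel {R : Type*} [CommRing R] (I : Ideal R) : Ideal (reesAlgebra I) where
  carrier := {f | ∀ i, (f : R[X]).coeff i ∈ I ^ (i + 1)}
  add_mem' hf hg i := by
    simpa using Ideal.add_mem _ (hf i) (hg i)
  zero_mem' i := by simp
  smul_mem' r f hf i := by
    simp only [smul_eq_mul, MulMemClass.coe_mul, coeff_mul]
    refine Ideal.sum_mem _ ?_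
    rintro ⟨j, k⟩ e
    rw [← (show j + k = i by simpa using e), add_assoc, pow_add]
    exact Ideal.mul_mem_mul (r.2 j) (hf k)

/-- The associated graded ring `gr_I(R) = ⨁ Iⁱ / Iⁱ⁺¹`, as a quotient of the Rees algebra. -/
def grRing {R : Type*} [CommRing R] (I : Ideal R) : Type _ :=
  reesAlgebra I ⧸ I.grKernel

noncomputable instance grRingCommRing {R : Type*} [CommRing R] (I : Ideal R) : CommRing I.grRing :=
  Ideal.Quotient.commRing I.grKernel

/-- The projection of the Rees algebra onto `gr_I(R)`. -/
noncomputable def grRingMk {R : Type*} [CommRing R] (I : Ideal R) :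
    reesAlgebra I →+* I.grRing :=
  Ideal.Quotient.mk I.grKernel

/-- The homogeneous maximal ideal `𝔪/I ⊕ ⨁_{i ≥ 1} Iⁱ / Iⁱ⁺¹` of `gr_I(R)`, for a local ring `R`
with maximal ideal `𝔪` and `I ≤ 𝔪`: the classes of the elements of the Rees algebra whose
constant coefficient lies in `𝔪`. -/
noncomputable def grMaximalIdeal {R : Type*} [CommRing R] [IsLocalRing R] (I : Ideal R) :
    Ideal I.grRing :=
  ((IsLocalRing.maximalIdeal R).comap
    ((Polynomial.constantCoeff (R := R)).comp (reesAlgebra I).val.toRingHom)).map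
      I.grRingMk

namespace Filtration

variable {R M : Type*} [CommRing R] [AddCommGroup M] [Module R M] {I : Ideal R}

/-- The filtration `n ↦ M_{n+1}`. -/
def shift (F : I.Filtration M) : I.Filtration M where
  N i := F.N (i + 1)
  mono i := F.mono (i + 1)
  smul_le i := F.smul_le (i + 1)

/-- The filtration `𝕄/N = {(M_n + N)/N}` induced on the quotient module `M/N`. -/
def quotient (F : I.Filtration M) (N : Submodule R M) : I.Filtration (M ⧸ N) where
  N i := (F.N i).map N.mkQ
  mono i := Submodule.map_mono (F.mono i)
  smul_le i := by
    rw [← Submodule.map_smul'']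
    exact Submodule.map_mono (F.smul_le i)

/-- The projection of `M[t]` modulo `⨁ M_{i+1} tⁱ`. -/
noncomputable def grMkQ (F : I.Filtration M) :
    PolynomialModule R M →ₗ[reesAlgebra I] PolynomialModule R M ⧸ F.shift.submodule :=
  F.shift.submodule.mkQ

/-- The associated graded module `gr_𝕄(M) = ⨁ M_i / M_{i+1}`: the image of the Rees module
`⨁ M_i tⁱ` in the quotient of `M[t]` by `⨁ M_{i+1} tⁱ`. -/
abbrev gr (F : I.Filtration M) : Type _ :=
  F.submodule.map F.grMkQ

theorem gr_isTorsionBySet (F : I.Filtration M) :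
    Module.IsTorsionBySet (reesAlgebra I) F.gr (I.grKernel : Set (reesAlgebra I)) := by
  rintro x ⟨a, ha⟩
  obtain ⟨_, m, hm, rfl⟩ := x
  refine Subtype.ext ?_
  change a • F.grMkQ m = 0
  rw [← map_smul]
  refine (Submodule.Quotient.mk_eq_zero _).2 fun i => ?_
  rw [Subalgebra.smul_def, PolynomialModule.smul_apply]
  refine Submodule.sum_mem _ ?_
  rintro ⟨j, k⟩ e
  have h := F.pow_smul_le (j + 1) k (Submodule.smul_mem_smul (ha j) (hm k))
  have e : j + k = i := by simpa using e
  change _ ∈ F.N (i + 1)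
  rwa [show i + 1 = j + 1 + k by lia]

/-- `gr_𝕄(M)` is a module over `gr_I(R)`. -/
noncomputable instance grModule (F : I.Filtration M) : Module I.grRing F.gr :=
  F.gr_isTorsionBySet.module

/-- The depth of `gr_𝕄(M)`, as a `gr_I(R)`-module, in the homogeneous maximal ideal. -/
noncomputable def grDepth [IsLocalRing R] (F : I.Filtration M) : ℕ∞ :=
  I.grMaximalIdeal.depth F.gr

/-- An element `a ∈ I` is `𝕄`-superficial for `I` if there is `c ≥ 0` such that
`(M_{n+1} :_M a) ∩ M_c = M_n` for all `n ≥ c`. -/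
def IsSuperficial (F : I.Filtration M) (a : R) : Prop :=
  a ∈ I ∧ ∃ c : ℕ, ∀ n ≥ c, (F.N (n + 1)).colonElem a ⊓ F.N c = F.N n

/-- A sequence `a_0, …, a_{r-1}` is `𝕄`-superficial for `I` if every `a_i` is superficial for `I`
with respect to the filtration induced by `𝕄` on `M/(a_0, …, a_{i-1})M`. -/
def IsSuperficialSeq (F : I.Filtration M) {r : ℕ} (a : Fin r → R) : Prop :=
  ∀ i : Fin r,
    (F.quotient (Ideal.span (a '' {j | j < i}) • (⊤ : Submodule R M))).IsSuperficial (a i)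

/-- A filtration of `M` (starting at `M_0 = M`) is good if `I M_n = M_{n+1}` for all large `n`. -/
def IsGood (F : I.Filtration M) : Prop :=
  F.N 0 = ⊤ ∧ F.Stable

/-- The Hilbert function `n ↦ λ(M_n / M_{n+1})`. -/
noncomputable def hilbertFunction (F : I.Filtration M) (n : ℕ) : ℕ :=
  ((F.N n).relLength (F.N (n + 1))).toNat

/-- The Hilbert series `∑ λ(M_n / M_{n+1}) tⁿ`. -/
noncomputable def hilbertSeries (F : I.Filtration M) : PowerSeries ℤ :=
  PowerSeries.mk fun n => (F.hilbertFunction n : ℤ)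

/-- `h` is the `h`-polynomial of the filtration: the Hilbert series is `h(t) / (1 - t)^d`, where
`d = dim M`. -/
def IsHPolynomial (F : I.Filtration M) (h : ℤ[X]) : Prop :=
  (h : PowerSeries ℤ) = (1 - PowerSeries.X) ^ Module.natDim R M * F.hilbertSeries

open Classical in
/-- The `h`-polynomial of the filtration (`0` if there is none). -/
noncomputable def hPolynomial (F : I.Filtration M) : ℤ[X] :=
  if H : ∃ h, F.IsHPolynomial h then H.choose else 0

/-- The Hilbert coefficient `e_i(𝕄) = h^{(i)}(1) / i!`, with `h` the `h`-polynomial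
(the `i`-th Hasse derivative is the `i`-th derivative divided by `i!`). -/
noncomputable def hilbertCoeff (F : I.Filtration M) (i : ℕ) : ℤ :=
  (Polynomial.hasseDeriv i F.hPolynomial).eval 1

end Filtration

end Ideal

/-! ### Lengths of quotients and the syzygies of a pair of elements. -/

namespace Submodule

variable {R M M' : Type*} [CommRing R] [AddCommGroup M] [Module R M] [AddCommGroup M'] [Module R M']

/-! Write `H` for a Hilbert function and `ΔH` for its first difference. Since `J` is a reduction of
`F`, both `F` and the `J`-adic filtration `N` are good `J`-filtrations. Their Hilbert functions are
eventually linear with the same slope `e`, and `e₂ = ∑ (n+1)(e - ΔH(n))`. Hence `e₂(F) - e₂(N) = ∑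
(n+1)(ΔH_N(n) - ΔH_F(n))`, and it suffices to bound the summands.

Two exact length counts compute `ΔH(n)` for a `J`-filtration `G`. The Koszul count
(`hilbertFunction_succ_sub_eq`) gives `c + u n - w (n+1) - v (n+1)`, where `c = λ(M/JM)`, `v n =
λ(G_{n+1}/J G_n)`, `u n` measures `(G_{n+1} : J)` against `G_n`, and `w n` is the length of the
image of the first Koszul homology modulo `G_n`. Multiplying by `a₁` on `M` and by `a₂` on `M/a₁M`
(`hilbertFunction_succ_sub_eq_colonElem`) gives an analogous formula in which `u` is replaced by a
difference of the lengths `s n = λ((G_{n+1} : a₁)/G_n)`.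

The terms `w` can only grow when the filtration shrinks, so `N ≤ F` lets them be dropped. In the
second count, summation by parts turns the differences of `s` into `-∑ s n` for `F`, which is
nonpositive, and into the second sum of the statement for `N`. If `gr_N(M)` has positive depth, `u`
vanishes for `N` and the Koszul count gives the sharper bound directly. -/

theorem length_quotient_eq_comap_add (f : M' →ₗ[R] M) (X : Submodule R M) :
    Module.length R (M ⧸ X) =
      Module.length R (M' ⧸ X.comap f) + Module.length R (M ⧸ X ⊔ LinearMap.range f) := by
  refine Module.length_eq_add_of_exact ((X.comap f).mapQ X f le_rfl)
    (factor (le_sup_left : X ≤ X ⊔ LinearMap.range f)) ?_ (factor_surjective _) ?_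
  · rw [← LinearMap.ker_eq_bot, ker_mapQ]
    simp
  · rw [LinearMap.exact_iff]
    ext y
    obtain ⟨y, rfl⟩ := X.mkQ_surjective y
    have h : factor (le_sup_left : X ≤ X ⊔ LinearMap.range f) (X.mkQ y) = 0 ↔
        y ∈ X ⊔ LinearMap.range f :=
      Submodule.Quotient.mk_eq_zero _
    rw [LinearMap.mem_ker, h, mem_sup, LinearMap.mem_range]
    constructor
    · rintro ⟨x, hx, _, ⟨z, rfl⟩, rfl⟩
      refine ⟨(X.comap f).mkQ z, ?_⟩
      rw [map_add, (show X.mkQ x = 0 from (Submodule.Quotient.mk_eq_zero X).2 hx), zero_add]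
      rfl
    · rintro ⟨z, hz⟩
      obtain ⟨z, rfl⟩ := (X.comap f).mkQ_surjective z
      exact ⟨_, (Submodule.Quotient.eq X).1 hz.symm, _, ⟨z, rfl⟩, by simp⟩

theorem length_quotient_comap_of_surjective {f : M' →ₗ[R] M} (hf : Function.Surjective f)
    (X : Submodule R M) :
    Module.length R (M' ⧸ X.comap f) = Module.length R (M ⧸ X) := by
  rw [length_quotient_eq_comap_add f X, LinearMap.range_eq_top.2 hf, sup_top_eq]
  simp

theorem length_quotient_eq_relLength_add {A B : Submodule R M} (h : B ≤ A) :
    Module.length R (M ⧸ B) = A.relLength B + Module.length R (M ⧸ A) := by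
  rw [length_quotient_eq_comap_add A.subtype B, range_subtype, sup_eq_right.2 h]
  rfl

theorem relLength_sup_le (A B F : Submodule R M) :
    (A ⊔ F).relLength (B ⊔ F) ≤ A.relLength B := by
  refine Module.length_le_of_surjective
    ((B.submoduleOf A).mapQ ((B ⊔ F).submoduleOf (A ⊔ F)) (inclusion le_sup_left) ?_) ?_
  · intro x hx
    exact (le_sup_left : B ≤ B ⊔ F) hx
  · intro y
    obtain ⟨⟨y, hy⟩, rfl⟩ := mkQ_surjective _ y
    obtain ⟨a, ha, z, hz, rfl⟩ := mem_sup.1 hy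
    refine ⟨(B.submoduleOf A).mkQ ⟨a, ha⟩, ?_⟩
    refine (Submodule.Quotient.eq ((B ⊔ F).submoduleOf (A ⊔ F))).2 ?_
    change a - (a + z) ∈ B ⊔ F
    exact mem_sup_right (by simpa using hz)

/-- The source of every inequality between two filtrations: a fixed subquotient has a smaller image
modulo a larger submodule. -/
theorem relLength_sup_anti (A B : Submodule R M) {F G : Submodule R M} (h : G ≤ F) :
    (A ⊔ F).relLength (B ⊔ F) ≤ (A ⊔ G).relLength (B ⊔ G) := by
  have := relLength_sup_le (A ⊔ G) (B ⊔ G) F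
  rwa [sup_assoc, sup_assoc, sup_eq_right.2 h] at this

theorem relLength_eq_zero {A B : Submodule R M} (h : A ≤ B) : A.relLength B = 0 := by
  have : Subsingleton (A ⧸ B.submoduleOf A) := by
    rw [submoduleOf_eq_top.2 h]
    infer_instance
  exact Module.length_eq_zero

theorem length_quotient_prod_self (G : Submodule R M) :
    Module.length R ((M × M) ⧸ G.prod G) = 2 * Module.length R (M ⧸ G) := by
  have h : G.prod G ⊔ LinearMap.range (LinearMap.inl R M M) =
      G.comap (LinearMap.snd R M M) := by
    ext ⟨x, y⟩
    simp only [mem_sup, mem_prod, LinearMap.mem_range, mem_comap, LinearMap.snd_apply]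
    constructor
    · rintro ⟨⟨u, v⟩, ⟨-, hv⟩, _, ⟨z, rfl⟩, e⟩
      simp only [LinearMap.inl_apply, Prod.mk_add_mk, add_zero, Prod.mk.injEq] at e
      exact e.2 ▸ hv
    · intro hy
      exact ⟨(0, y), ⟨G.zero_mem, hy⟩, (x, 0), ⟨x, rfl⟩, by simp⟩
  have h' : (G.prod G).comap (LinearMap.inl R M M) = G := by
    ext x
    simp
  rw [length_quotient_eq_comap_add (LinearMap.inl R M M), h, h',
    length_quotient_comap_of_surjective (f := LinearMap.snd R M M)
      LinearMap.snd_surjective, two_mul]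

theorem mem_colonElem {B : Submodule R M} {a : R} {x : M} : x ∈ B.colonElem a ↔ a • x ∈ B :=
  Iff.rfl

/-- The pairs `(x, y)` with `a x + b y = 0`. -/
def pairSyzygies (R M : Type*) [CommRing R] [AddCommGroup M] [Module R M] (a b : R) :
    Submodule R (M × M) :=
  LinearMap.ker ((LinearMap.lsmul R M a).coprod (LinearMap.lsmul R M b))

/-- The pairs `(b z, -a z)`. -/
def koszulSyzygies (R M : Type*) [CommRing R] [AddCommGroup M] [Module R M] (a b : R) :
    Submodule R (M × M) :=
  LinearMap.range ((LinearMap.lsmul R M b).prod (-LinearMap.lsmul R M a))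

theorem koszulSyzygies_le (a b : R) : koszulSyzygies R M a b ≤ pairSyzygies R M a b := by
  rintro _ ⟨z, rfl⟩
  simp [pairSyzygies, smul_smul, mul_comm]

/-- The ideal `(a, b)` kills the first Koszul homology; this is what makes that homology of finite
length. -/
theorem smul_mem_koszulSyzygies {a b : R} {z : M × M} (hz : z ∈ pairSyzygies R M a b) {r : R}
    (hr : r ∈ Ideal.span {a, b}) : r • z ∈ koszulSyzygies R M a b := by
  obtain ⟨x, y⟩ := z
  have h : a • x + b • y = 0 := by simpa [pairSyzygies] using hz
  obtain ⟨s, t, rfl⟩ := Ideal.mem_span_pair.1 hr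
  refine ⟨t • x - s • y, ?_⟩
  refine Prod.ext (?_ : b • (t • x - s • y) = (s * a + t * b) • x)
    (?_ : -(a • (t • x - s • y)) = (s * a + t * b) • y)
  · rw [add_smul, mul_smul, mul_smul, eq_neg_of_add_eq_zero_left h, smul_sub,
      smul_comm b t, smul_comm b s]
    module
  · rw [add_smul, mul_smul, mul_smul, eq_neg_of_add_eq_zero_right h, smul_sub,
      smul_comm a t, smul_comm a s]
    module

theorem map_prod_self_coprod_lsmul (a b : R) (G : Submodule R M) :
    (G.prod G).map ((LinearMap.lsmul R M a).coprod (LinearMap.lsmul R M b)) =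
      Ideal.span {a, b} • G := by
  refine le_antisymm ?_ (smul_le.2 ?_)
  · rintro _ ⟨⟨x, y⟩, ⟨hx, hy⟩, rfl⟩
    exact add_mem (smul_mem_smul (Ideal.subset_span (by simp)) hx)
      (smul_mem_smul (Ideal.subset_span (by simp)) hy)
  · intro r hr x hx
    obtain ⟨s, t, rfl⟩ := Ideal.mem_span_pair.1 hr
    refine ⟨(s • x, t • x), ⟨G.smul_mem _ hx, G.smul_mem _ hx⟩, ?_⟩
    simp [add_smul, mul_smul]

theorem span_pair_smul (a b : R) (G : Submodule R M) :
    Ideal.span {a, b} • G =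
      G.map (LinearMap.lsmul R M a) ⊔ G.map (LinearMap.lsmul R M b) := by
  rw [← map_prod_self_coprod_lsmul]
  ext x
  simp only [mem_map, mem_prod, mem_sup, Prod.exists, LinearMap.coprod_apply]
  constructor
  · rintro ⟨u, v, ⟨hu, hv⟩, rfl⟩
    exact ⟨_, ⟨u, hu, rfl⟩, _, ⟨v, hv, rfl⟩, rfl⟩
  · rintro ⟨_, ⟨u, hu, rfl⟩, _, ⟨v, hv, rfl⟩, rfl⟩
    exact ⟨u, v, ⟨hu, hv⟩, rfl⟩

/-- Length count in the Koszul complex of `a, b` on `M`, filtered by `G`. -/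
theorem two_mul_length_quotient_add (a b : R) (G : Submodule R M) :
    2 * Module.length R (M ⧸ G) +
        Module.length R (M ⧸ (Ideal.span {a, b} • ⊤ : Submodule R M)) =
      Module.length R (M ⧸ G.colonElem a ⊓ G.colonElem b) +
        (pairSyzygies R M a b ⊔ G.prod G).relLength (koszulSyzygies R M a b ⊔ G.prod G) +
        Module.length R (M ⧸ (Ideal.span {a, b} • G : Submodule R M)) := by
  -- The maps are `z ↦ (bz, -az)` from `M` to `(M/G)²` and `(x, y) ↦ ax + by` from `(M/G)²` to
  -- `M/JG`, with `J = (a, b)`. The first has kernel `(G : a) ∩ (G : b)`, the second has cokernel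
  -- `M/JM`, and the `relLength` term is the homology in the middle.
  have h₁ := length_quotient_eq_comap_add
    ((LinearMap.lsmul R M a).coprod (LinearMap.lsmul R M b)) (Ideal.span {a, b} • G)
  have h₂ := length_quotient_eq_comap_add
    ((LinearMap.lsmul R M b).prod (-LinearMap.lsmul R M a)) (G.prod G)
  have e : (G.prod G).comap ((LinearMap.lsmul R M b).prod (-LinearMap.lsmul R M a)) =
      G.colonElem a ⊓ G.colonElem b := by
    ext x
    simp [mem_colonElem, and_comm]
  have e' : (Ideal.span {a, b} • G) ⊔
      LinearMap.range ((LinearMap.lsmul R M a).coprod (LinearMap.lsmul R M b)) =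
      Ideal.span {a, b} • ⊤ := by
    rw [← Submodule.map_top, ← prod_top, map_prod_self_coprod_lsmul,
      sup_eq_right.2 (smul_mono_right _ le_top)]
  rw [e', ← map_prod_self_coprod_lsmul a b G, comap_map_eq, sup_comm] at h₁
  rw [e, length_quotient_prod_self, sup_comm, ← koszulSyzygies, length_quotient_eq_relLength_add
    (sup_le_sup_right (koszulSyzygies_le a b) (G.prod G))] at h₂
  rw [← map_prod_self_coprod_lsmul a b G, h₁, h₂, pairSyzygies]
  abel

theorem length_quotient_eq_colonElem_add (a : R) (G : Submodule R M) :
    Module.length R (M ⧸ G) = Module.length R (M ⧸ G.colonElem a) +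
      Module.length R (M ⧸ G ⊔ (⊤ : Submodule R M).map (LinearMap.lsmul R M a)) := by
  rw [Submodule.map_top]
  exact length_quotient_eq_comap_add (LinearMap.lsmul R M a) G

/-- Multiplication by `b` on `M/aM`, where `(a, b)G` becomes `bG`. -/
theorem length_quotient_span_pair_smul_sup (a b : R) (G : Submodule R M) :
    Module.length R
        (M ⧸ Ideal.span {a, b} • G ⊔ (⊤ : Submodule R M).map (LinearMap.lsmul R M a)) =
      Module.length R
        (M ⧸ G ⊔ ((⊤ : Submodule R M).map (LinearMap.lsmul R M a)).colonElem b) +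
      Module.length R (M ⧸ (Ideal.span {a, b} • ⊤ : Submodule R M)) := by
  set A := (⊤ : Submodule R M).map (LinearMap.lsmul R M a) with hA
  have e : Ideal.span {a, b} • G ⊔ A = G.map (LinearMap.lsmul R M b) ⊔ A := by
    rw [span_pair_smul, sup_right_comm,
      sup_eq_right.2 (map_mono le_top : G.map (LinearMap.lsmul R M a) ≤ _), sup_comm]
  have e₁ : (G.map (LinearMap.lsmul R M b) ⊔ A) ⊔ LinearMap.range (LinearMap.lsmul R M b) =
      Ideal.span {a, b} • ⊤ := by
    rw [span_pair_smul, ← Submodule.map_top, sup_right_comm,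
      sup_eq_right.2 (map_mono le_top : G.map (LinearMap.lsmul R M b) ≤ _), sup_comm]
  have e₂ : (G.map (LinearMap.lsmul R M b) ⊔ A).comap (LinearMap.lsmul R M b) =
      G ⊔ A.colonElem b := by
    refine le_antisymm ?_ (sup_le (map_le_iff_le_comap.1 le_sup_left) (comap_mono le_sup_right))
    intro x hx
    obtain ⟨_, ⟨y, hy, rfl⟩, z, hz, h⟩ := mem_sup.1 (mem_comap.1 hx)
    refine mem_sup.2 ⟨y, hy, x - y, ?_, by simp⟩
    rw [mem_colonElem, smul_sub]
    rw [LinearMap.lsmul_apply, LinearMap.lsmul_apply] at h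
    rwa [← h, add_sub_cancel_left]
  rw [e, length_quotient_eq_comap_add (LinearMap.lsmul R M b), e₁, e₂]

end Submodule

/-! ### Finite length from powers of the maximal ideal. -/

section FiniteLength

open IsLocalRing

variable {R M : Type*} [CommRing R] [IsLocalRing R] [AddCommGroup M] [Module R M]

theorem exists_maximalIdeal_pow_le_pow_sup_annihilator {J : Ideal R} {k : ℕ}
    (h : maximalIdeal R ^ k ≤ J ⊔ Module.annihilator R M) (n : ℕ) :
    maximalIdeal R ^ (k * n) ≤ J ^ n ⊔ Module.annihilator R M := by
  rw [pow_mul]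
  refine (Ideal.pow_right_mono h n).trans ?_
  induction n with
  | zero => simp
  | succ n ih =>
    rw [pow_succ, pow_succ]
    refine (Ideal.mul_mono_left ih).trans ?_
    rw [Ideal.sup_mul, Ideal.mul_sup]
    exact sup_le (sup_le le_sup_left (Ideal.mul_le_right.trans le_sup_right))
      (Ideal.mul_le_left.trans le_sup_right)

variable [IsNoetherianRing R]

theorem Module.length_ne_top_of_maximalIdeal_pow_le {I : Ideal R} {k : ℕ}
    (hI : maximalIdeal R ^ k ≤ I) {X : Type*} [AddCommGroup X] [Module R X] [Module.Finite R X]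
    (hX : ∀ r ∈ I, ∀ x : X, r • x = 0) : Module.length R X ≠ ⊤ := by
  by_cases h : I = ⊤
  · have : Subsingleton X := subsingleton_of_forall_eq 0 fun x => by
      simpa using hX 1 (h ▸ Submodule.mem_top) x
    simp
  have hmin : maximalIdeal R ∈ I.minimalPrimes :=
    ⟨⟨inferInstance, le_maximalIdeal h⟩, fun P hP _ =>
      hP.1.le_of_pow_le (hI.trans hP.2)⟩
  have := quotient_artinian_of_mem_minimalPrimes_of_isLocalRing I hmin
  have ht : Module.IsTorsionBySet R X (I : Set R) := fun x r => hX r r.2 x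
  let := ht.module
  have : IsScalarTower R (R ⧸ I) X := ht.isScalarTower
  have : Module.Finite (R ⧸ I) X := Module.Finite.of_restrictScalars_finite R _ _
  rw [Module.length_eq_of_surjective (R := R ⧸ I) Ideal.Quotient.mk_surjective]
  exact Module.length_ne_top

theorem Ideal.exists_maximalIdeal_pow_le_of_forall_isPrime {I : Ideal R}
    (h : ∀ P : Ideal R, P.IsPrime → I ≤ P → P = maximalIdeal R) :
    ∃ k, maximalIdeal R ^ k ≤ I := by
  refine Ideal.exists_pow_le_of_le_radical_of_fg ?_ (IsNoetherian.noetherian _)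
  rw [Ideal.radical_eq_sInf]
  exact le_sInf fun P hP => (h P hP.2 hP.1).ge

theorem length_quotient_ne_top_of_pow_smul_le [Module.Finite R M] {J : Ideal R} {k : ℕ}
    (h : maximalIdeal R ^ k ≤ J ⊔ Module.annihilator R M) {n : ℕ} {X : Submodule R M}
    (hX : J ^ n • (⊤ : Submodule R M) ≤ X) : Module.length R (M ⧸ X) ≠ ⊤ := by
  refine Module.length_ne_top_of_maximalIdeal_pow_le
    (exists_maximalIdeal_pow_le_pow_sup_annihilator h n) fun r hr x => ?_
  obtain ⟨x, rfl⟩ := X.mkQ_surjective x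
  obtain ⟨s, hs, t, ht, rfl⟩ := Submodule.mem_sup.1 hr
  rw [← map_smul, add_smul, Module.mem_annihilator.1 ht, add_zero]
  exact (Submodule.Quotient.mk_eq_zero _).2 (hX (Submodule.smul_mem_smul hs trivial))

theorem relLength_ne_top_of_smul_le {J : Ideal R} {k : ℕ}
    (h : maximalIdeal R ^ k ≤ J ⊔ Module.annihilator R M)
    {X : Type*} [AddCommGroup X] [Module R X] [Module.Finite R X]
    (hX : ∀ r ∈ Module.annihilator R M, ∀ x : X, r • x = 0)
    {A B : Submodule R X} (hAB : ∀ r ∈ J, ∀ x ∈ A, r • x ∈ B) : A.relLength B ≠ ⊤ := by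
  refine Module.length_ne_top_of_maximalIdeal_pow_le h fun r hr x => ?_
  obtain ⟨⟨x, hxA⟩, rfl⟩ := Submodule.mkQ_surjective _ x
  obtain ⟨s, hs, t, ht, rfl⟩ := Submodule.mem_sup.1 hr
  refine (Submodule.Quotient.mk_eq_zero _).2 (?_ : (s + t) • x ∈ B)
  rw [add_smul, hX t ht, add_zero]
  exact hAB s hs x hxA

end FiniteLength

/-! ### Good filtrations and superficial elements. -/

namespace Ideal.Filtration

variable {R M : Type*} [CommRing R] [AddCommGroup M] [Module R M] {I : Ideal R}

theorem Stable.quotient {F : I.Filtration M} (hF : F.Stable) (N : Submodule R M) :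
    (F.quotient N).Stable := by
  obtain ⟨n₀, h⟩ := hF
  refine ⟨n₀, fun n hn => ?_⟩
  change I • (F.N n).map N.mkQ = (F.N (n + 1)).map N.mkQ
  rw [← Submodule.map_smul'', h n hn]

theorem IsGood.quotient {F : I.Filtration M} (hF : F.IsGood) (N : Submodule R M) :
    (F.quotient N).IsGood := by
  refine ⟨?_, Stable.quotient hF.2 N⟩
  change (F.N 0).map N.mkQ = ⊤
  rw [hF.1, Submodule.map_top, Submodule.range_mkQ]

theorem pow_smul_top_le {F : I.Filtration M} (h0 : F.N 0 = ⊤) (n : ℕ) :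
    I ^ n • (⊤ : Submodule R M) ≤ F.N n := by
  rw [← h0]
  exact F.pow_smul_le n 0

theorem Stable.exists_le_pow_smul_top {F : I.Filtration M} (hF : F.Stable) :
    ∃ n₀, ∀ n, F.N (n + n₀) ≤ I ^ n • (⊤ : Submodule R M) :=
  hF.exists_forall_le (F' := I.stableFiltration ⊤) (by simp)

theorem Stable.eventually_le {F : I.Filtration M} (hF : F.Stable) {G : I.Filtration M}
    (hG : G.N 0 = ⊤) (c : ℕ) : ∃ n₀, ∀ n ≥ n₀, F.N n ≤ G.N c := by
  obtain ⟨n₀, h⟩ := hF.exists_le_pow_smul_top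
  exact ⟨c + n₀, fun n hn => (F.antitone hn).trans ((h c).trans (pow_smul_top_le hG c))⟩

theorem Stable.iInf_eq_bot [IsLocalRing R] [IsNoetherianRing R] [Module.Finite R M]
    {F : I.Filtration M} (hF : F.Stable) (hI : I ≠ ⊤) : ⨅ n, F.N n = ⊥ := by
  obtain ⟨n₀, h⟩ := hF.exists_le_pow_smul_top
  rw [eq_bot_iff, ← Ideal.iInf_pow_smul_eq_bot_of_isLocalRing (M := M) I hI]
  exact le_iInf fun n => (iInf_le _ (n + n₀)).trans (h n)

theorem IsSuperficial.of_quotient {F : I.Filtration M} {N : Submodule R M} (hN : N = ⊥) {a : R}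
    (h : (F.quotient N).IsSuperficial a) : F.IsSuperficial a := by
  subst hN
  have key (X : Submodule R M) (x : M) :
      Submodule.mkQ ⊥ x ∈ X.map (Submodule.mkQ ⊥) ↔ x ∈ X := by
    rw [← Submodule.mem_comap, Submodule.comap_map_mkQ, bot_sup_eq]
  obtain ⟨ha, c, hc⟩ := h
  refine ⟨ha, c, fun n hn => ?_⟩
  ext x
  have := SetLike.ext_iff.1 (hc n hn) (Submodule.mkQ ⊥ x)
  change a • Submodule.mkQ ⊥ x ∈ (F.N (n + 1)).map (Submodule.mkQ ⊥) ∧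
    Submodule.mkQ ⊥ x ∈ (F.N c).map (Submodule.mkQ ⊥) ↔
    Submodule.mkQ ⊥ x ∈ (F.N n).map (Submodule.mkQ ⊥) at this
  rwa [← map_smul, key, key, key] at this

theorem IsSuperficialSeq.isSuperficial_fst {F : I.Filtration M} {a b : R}
    (h : F.IsSuperficialSeq ![a, b]) : F.IsSuperficial a := by
  refine (h 0).of_quotient ?_
  simp

theorem IsSuperficialSeq.isSuperficial_snd {F : I.Filtration M} {a b : R}
    (h : F.IsSuperficialSeq ![a, b]) :
    (F.quotient (Ideal.span {a} • (⊤ : Submodule R M))).IsSuperficial b := by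
  have h1 := h 1
  have : {j : Fin 2 | j < 1} = {0} := by
    ext j
    simp
  rw [this, Set.image_singleton] at h1
  exact h1

/-- An element of `M_c` killed by `a` lies in every `M_n` with `n ≥ c`, so Krull's intersection
theorem makes it zero. -/
theorem IsSuperficial.exists_colonElem_bot_inf_eq_bot [IsLocalRing R] [IsNoetherianRing R]
    [Module.Finite R M] {F : I.Filtration M} (hF : F.Stable) (hI : I ≠ ⊤) {a : R}
    (ha : F.IsSuperficial a) : ∃ c, (⊥ : Submodule R M).colonElem a ⊓ F.N c = ⊥ := by
  obtain ⟨-, c, hc⟩ := ha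
  refine ⟨c, ?_⟩
  refine eq_bot_iff.2 ((le_iInf fun n => (le_trans ?_ (hc (max n c) (le_max_right _ _)).le).trans
    (F.antitone (le_max_left n c))).trans (hF.iInf_eq_bot hI).le)
  exact inf_le_inf_right _
    (Submodule.comap_mono bot_le : (⊥ : Submodule R M).colonElem a ≤ (F.N _).colonElem a)

/-- If `P` is the annihilator of `x`, then `I^c x` lies in `M_c` and is killed by `a`, hence is
zero, so `I^c ≤ P`. -/
theorem IsSuperficial.le_of_mem_associatedPrimes [IsLocalRing R] [IsNoetherianRing R]
    [Module.Finite R M] {F : I.Filtration M} (hF : F.IsGood) (hI : I ≠ ⊤) {a : R}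
    (ha : F.IsSuperficial a) {P : Ideal R} (hP : P ∈ associatedPrimes R M) (haP : a ∈ P) :
    I ≤ P := by
  obtain ⟨c, hc⟩ := ha.exists_colonElem_bot_inf_eq_bot hF.2 hI
  obtain ⟨hprime, x, rfl⟩ := isAssociatedPrime_iff.1 hP
  refine hprime.le_of_pow_le (n := c) fun y hy => ?_
  rw [Submodule.mem_colon_singleton, Submodule.mem_bot] at haP ⊢
  rw [← Submodule.mem_bot R, ← hc]
  refine ⟨?_, pow_smul_top_le hF.1 c (Submodule.smul_mem_smul hy trivial)⟩
  rw [SetLike.mem_coe, Submodule.mem_colonElem, smul_comm, haP, smul_zero]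
  exact zero_mem _

theorem IsSuperficial.isSMulRegular [IsLocalRing R] [IsNoetherianRing R]
    [Module.Finite R M] {F : I.Filtration M} (hF : F.IsGood) (hI : I ≠ ⊤) {a : R}
    (ha : F.IsSuperficial a) {r : R} (hr : r ∈ I.radical) (hrM : IsSMulRegular M r) :
    IsSMulRegular M a := by
  obtain ⟨c, hc⟩ := ha.exists_colonElem_bot_inf_eq_bot hF.2 hI
  obtain ⟨t, ht⟩ := hr
  rw [isSMulRegular_iff_right_eq_zero_of_smul]
  intro x hx
  refine (hrM.pow (t * c)).right_eq_zero_of_smul ?_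
  rw [← Submodule.mem_bot R, ← hc]
  refine ⟨?_, pow_smul_top_le hF.1 c (Submodule.smul_mem_smul ?_ trivial)⟩
  · rw [SetLike.mem_coe, Submodule.mem_colonElem, smul_comm, hx, smul_zero]
    exact zero_mem _
  · rw [pow_mul]
    exact Ideal.pow_mem_pow ht c

/-- Artin–Rees puts `M_{n+1} ∩ aM` inside `a M_c` for large `n`; there the superficial condition
applies. -/
theorem IsSuperficial.exists_inf_map_lsmul_le [IsNoetherianRing R]
    [Module.Finite R M] {F : I.Filtration M} (hF : F.IsGood) {a : R} (ha : F.IsSuperficial a) :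
    ∃ n₀, ∀ n ≥ n₀, F.N (n + 1) ⊓ (⊤ : Submodule R M).map (LinearMap.lsmul R M a) ≤
      (F.N n).map (LinearMap.lsmul R M a) := by
  obtain ⟨-, c, hc⟩ := ha
  set A := (⊤ : Submodule R M).map (LinearMap.lsmul R M a) with hA
  obtain ⟨k, hk⟩ := (hF.2.inter_right (F' := I.trivialFiltration A)).exists_pow_smul_eq_of_ge
  refine ⟨c + k, fun n hn => ?_⟩
  have h1 : F.N (n + 1) ⊓ A ≤ (F.N c).map (LinearMap.lsmul R M a) := by
    refine (hk (n + 1) (by lia)).le.trans ?_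
    refine (smul_mono_right _ (inf_le_right : _ ≤ A)).trans ?_
    rw [hA, ← Submodule.map_smul'']
    exact Submodule.map_mono ((pow_smul_top_le hF.1 _).trans (F.antitone (by lia)))
  intro x hx
  obtain ⟨z, hz, rfl⟩ := h1 hx
  exact ⟨z, (hc n (by lia)).le ⟨hx.1, hz⟩, rfl⟩

end Ideal.Filtration

/-! ### A superficial sequence generates a reduction. -/

namespace Ideal.Filtration

open IsLocalRing

variable {R M : Type*} [CommRing R] [IsLocalRing R] [IsNoetherianRing R] [AddCommGroup M]
  [Module R M] [Module.Finite R M] {I : Ideal R}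

/-- A superficial sequence of length two generates, modulo the annihilator of a module of dimension
at most two, an ideal that is primary to the maximal ideal. -/
theorem IsSuperficialSeq.exists_maximalIdeal_pow_le (hdim : Module.supportDim R M ≤ 2)
    (hI : I.radical = maximalIdeal R) {F : I.Filtration M} (hF : F.IsGood) {a b : R}
    (h : F.IsSuperficialSeq ![a, b]) :
    ∃ k, maximalIdeal R ^ k ≤ Ideal.span {a, b} ⊔ Module.annihilator R M := by
  have hIm : I ≤ maximalIdeal R := hI ▸ Ideal.le_radical
  have hItop : I ≠ ⊤ := fun e => (maximalIdeal.isMaximal R).ne_top (top_le_iff.1 (e ▸ hIm))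
  have key {P : Ideal R} (hP : P.IsPrime) (hIP : I ≤ P) : maximalIdeal R ≤ P :=
    hI ▸ hP.radical_le_iff.2 hIP
  -- A non-maximal prime `P` over the ideal would give a chain `P₀ < P₁ < P < 𝔪` in the support, too
  -- long for dimension two. Here `P₁` is minimal over the annihilator of `M/aM` and `P₀` over that
  -- of `M`, so both are associated primes. Either inclusion becoming an equality would put a
  -- superficial element in an associated prime, forcing `I`, and then `𝔪`, into `P`.
  refine exists_maximalIdeal_pow_le_of_forall_isPrime fun P hP hle => ?_
  by_contra hne
  have hPm : P < maximalIdeal R := lt_of_le_of_ne (le_maximalIdeal hP.ne_top) hne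
  have haP : a ∈ P := hle (Ideal.mem_sup_left (Ideal.subset_span (by simp)))
  have hbP : b ∈ P := hle (Ideal.mem_sup_left (Ideal.subset_span (by simp)))
  have hannP : Module.annihilator R M ≤ P := le_sup_right.trans hle
  let M₁ := M ⧸ (Ideal.span {a} • ⊤ : Submodule R M)
  have hsupp (Q : PrimeSpectrum R) : Q ∈ Module.support R M₁ ↔
      Module.annihilator R M ≤ Q.asIdeal ∧ a ∈ Q.asIdeal := by
    rw [Module.support_quotient, Module.support_eq_zeroLocus, Set.mem_inter_iff,
      PrimeSpectrum.mem_zeroLocus, PrimeSpectrum.mem_zeroLocus, SetLike.coe_subset_coe,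
      SetLike.coe_subset_coe, Ideal.span_singleton_le_iff_mem]
  have hsupp' (Q : PrimeSpectrum R) :
      Module.annihilator R M₁ ≤ Q.asIdeal ↔ Q ∈ Module.support R M₁ := by
    rw [Module.support_eq_zeroLocus, PrimeSpectrum.mem_zeroLocus, SetLike.coe_subset_coe]
  obtain ⟨P₁, hP₁, hP₁P⟩ := Ideal.exists_minimalPrimes_le
    ((hsupp' ⟨P, hP⟩).2 ((hsupp ⟨P, hP⟩).2 ⟨hannP, haP⟩))
  have := hP₁.1.1
  have hP₁' : Module.annihilator R M ≤ P₁ ∧ a ∈ P₁ :=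
    (hsupp ⟨P₁, hP₁.1.1⟩).1 ((hsupp' ⟨P₁, hP₁.1.1⟩).1 hP₁.1.2)
  obtain ⟨P₀, hP₀, hP₀P₁⟩ := Ideal.exists_minimalPrimes_le hP₁'.1
  have hlt₁ : P₁ < P := by
    refine lt_of_le_of_ne hP₁P fun e => ?_
    refine (key hP (e ▸ h.isSuperficial_snd.le_of_mem_associatedPrimes (hF.quotient _) hItop
      (Module.associatedPrimes.minimalPrimes_annihilator_subset_associatedPrimes R M₁ hP₁)
      (e ▸ hbP))).not_gt hPm
  have hlt₀ : P₀ < P₁ := by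
    refine lt_of_le_of_ne hP₀P₁ fun e => ?_
    refine ((key hP₁.1.1 (e ▸ h.isSuperficial_fst.le_of_mem_associatedPrimes hF hItop
      (Module.associatedPrimes.minimalPrimes_annihilator_subset_associatedPrimes R M hP₀)
      (e ▸ hP₁'.2))).trans hP₁P).not_gt hPm
  have hmem (Q : PrimeSpectrum R) (hQ : Module.annihilator R M ≤ Q.asIdeal) :
      Q ∈ Module.support R M := by
    rwa [Module.support_eq_zeroLocus, PrimeSpectrum.mem_zeroLocus, SetLike.coe_subset_coe]
  let s : Fin 4 → Module.support R M :=
    ![⟨⟨P₀, hP₀.1.1⟩, hmem _ hP₀.1.2⟩, ⟨⟨P₁, hP₁.1.1⟩, hmem _ hP₁'.1⟩, ⟨⟨P, hP⟩, hmem _ hannP⟩,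
      ⟨⟨maximalIdeal R, inferInstance⟩, hmem _ (hannP.trans hPm.le)⟩]
  let L : LTSeries (Module.support R M) := ⟨3, s, fun i => by
    fin_cases i
    exacts [hlt₀, hlt₁, hPm]⟩
  have := (Order.LTSeries.length_le_krullDim L).trans hdim
  have h3 : ((3 : ℕ) : WithBot ℕ∞) ≤ ((2 : ℕ) : WithBot ℕ∞) := this
  norm_num at h3

/-- A superficial sequence of length two in dimension at most two generates a reduction. -/
theorem IsSuperficialSeq.exists_smul_eq (hdim : Module.supportDim R M ≤ 2)
    (hI : I.radical = maximalIdeal R) {F : I.Filtration M} (hF : F.IsGood) {a b : R}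
    (h : F.IsSuperficialSeq ![a, b]) :
    ∃ n₀, ∀ n ≥ n₀, Ideal.span {a, b} • F.N n = F.N (n + 1) := by
  have hIm : I ≤ maximalIdeal R := hI ▸ Ideal.le_radical
  have hJI : Ideal.span {a, b} ≤ I := by
    rw [Ideal.span_le, Set.pair_subset_iff]
    exact ⟨h.isSuperficial_fst.1, h.isSuperficial_snd.1⟩
  obtain ⟨k, hk⟩ := h.exists_maximalIdeal_pow_le hdim hI hF
  obtain ⟨n₁, h₁⟩ := hF.2.exists_le_pow_smul_top
  obtain ⟨n₂, h₂⟩ := h.isSuperficial_fst.exists_inf_map_lsmul_le hF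
  obtain ⟨n₃, h₃⟩ := h.isSuperficial_snd.exists_inf_map_lsmul_le (hF.quotient _)
  have hJ : ∀ n ≥ k + n₁, F.N n ≤ Ideal.span {a, b} • (⊤ : Submodule R M) := by
    intro n hn
    refine (F.antitone hn).trans ((h₁ k).trans (Submodule.smul_le.2 fun r hr x _ => ?_))
    obtain ⟨s, hs, t, ht, rfl⟩ := Submodule.mem_sup.1 (hk (Ideal.pow_right_mono hIm k hr))
    rw [add_smul, Module.mem_annihilator.1 ht, add_zero]
    exact Submodule.smul_mem_smul hs trivial
  refine ⟨k + n₁ + n₂ + n₃, fun n hn => le_antisymm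
    ((Submodule.smul_mono_left hJI).trans (F.smul_le n)) fun x hx => ?_⟩
  set A := Ideal.span {a} • (⊤ : Submodule R M) with hA
  have hA' : A = (⊤ : Submodule R M).map (LinearMap.lsmul R M a) := by
    rw [hA, Submodule.ideal_span_singleton_smul]
    rfl
  have hx' := hJ (n + 1) (by lia) hx
  rw [Submodule.span_pair_smul, Submodule.mem_sup] at hx'
  obtain ⟨_, ⟨u, -, rfl⟩, _, ⟨v, -, rfl⟩, huv⟩ := hx'
  -- Modulo `aM`, the superficial condition on `b` replaces `v` by some `y` in `M_n`. The difference
  -- `x - by` then lies in `M_{n+1} ∩ aM`, hence in `a M_n`.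
  have h4 : A.mkQ x ∈ (F.quotient A).N (n + 1) ⊓
      (⊤ : Submodule R (M ⧸ A)).map (LinearMap.lsmul R (M ⧸ A) b) := by
    refine ⟨⟨x, hx, rfl⟩, A.mkQ v, trivial, ?_⟩
    rw [← huv, map_add, (show A.mkQ (LinearMap.lsmul R M a u) = 0 from
      (Submodule.Quotient.mk_eq_zero A).2 (hA' ▸ ⟨u, trivial, rfl⟩)), zero_add]
    rfl
  obtain ⟨_, ⟨y, hy, rfl⟩, hyx⟩ := h₃ n (by lia) h4
  have hyx' : x - b • y ∈ A := (Submodule.Quotient.eq A).1 hyx.symm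
  have h5 := h₂ n (by lia) ⟨sub_mem hx (F.smul_le n (Submodule.smul_mem_smul
    h.isSuperficial_snd.1 hy)), hA' ▸ hyx'⟩
  rw [← sub_add_cancel x (b • y), Submodule.span_pair_smul]
  exact Submodule.add_mem_sup h5 ⟨y, hy, rfl⟩

end Ideal.Filtration

/-! ### Colon filtrations and their stability. -/

namespace Ideal.Filtration

variable {R M : Type*} [CommRing R] [AddCommGroup M] [Module R M] {I : Ideal R}

/-- The filtration `n ↦ (M_{n+1} :_M a)`. -/
def colonFiltration (F : I.Filtration M) (a : R) : I.Filtration M where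
  N n := (F.N (n + 1)).colonElem a
  mono n := Submodule.comap_mono (F.mono (n + 1))
  smul_le n := Submodule.smul_le.2 fun r hr x hx => by
    rw [Submodule.mem_colonElem, smul_comm]
    exact F.smul_le (n + 1) (Submodule.smul_mem_smul hr hx)

theorem le_colonFiltration (F : I.Filtration M) {a : R} (ha : a ∈ I) (n : ℕ) :
    F.N n ≤ (F.N (n + 1)).colonElem a := fun _ hx =>
  F.smul_le n (Submodule.smul_mem_smul ha hx)

variable [IsNoetherianRing R] [Module.Finite R M]

/-- Multiplication by the regular element `a` identifies `(M_{n+1} : a)` with `M_{n+1} ∩ aM`, to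
which Artin–Rees applies. -/
theorem Stable.colonFiltration {F : I.Filtration M} (hF : F.Stable) {a : R}
    (ha : IsSMulRegular M a) : (F.colonFiltration a).Stable := by
  set A := (⊤ : Submodule R M).map (LinearMap.lsmul R M a) with hA
  obtain ⟨n₀, h⟩ := hF.inter_right (F' := I.trivialFiltration A)
  have e (n : ℕ) : F.N (n + 1) ⊓ A =
      ((F.colonFiltration a).N n).map (LinearMap.lsmul R M a) := by
    refine le_antisymm ?_ (le_inf ?_ (Submodule.map_mono le_top))
    · rintro _ ⟨hx, y, -, rfl⟩
      exact ⟨y, hx, rfl⟩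
    · rintro _ ⟨y, hy, rfl⟩
      exact hy
  refine ⟨n₀, fun n hn => Submodule.map_injective_of_injective (f := LinearMap.lsmul R M a) ha ?_⟩
  rw [← e, Submodule.map_smul'', ← e]
  exact h (n + 1) (by lia)

theorem IsSuperficial.exists_colonElem_eq {F : I.Filtration M} (hF : F.IsGood) {a : R}
    (ha : F.IsSuperficial a) (hreg : IsSMulRegular M a) :
    ∃ n₀, ∀ n ≥ n₀, (F.N (n + 1)).colonElem a = F.N n := by
  obtain ⟨haI, c, hc⟩ := ha
  obtain ⟨n₀, h⟩ := (hF.2.colonFiltration hreg).eventually_le hF.1 c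
  refine ⟨n₀ + c, fun n hn => ?_⟩
  rw [← hc n (by lia), eq_comm, inf_eq_left]
  exact h n (by lia)

theorem Stable.exists_colonElem_inf_eq {a b : R} {F : (Ideal.span {a, b}).Filtration M}
    (hF : F.Stable) (ha : IsSMulRegular M a) :
    ∃ n₀, ∀ n ≥ n₀, (F.N (n + 1)).colonElem a ⊓ (F.N (n + 1)).colonElem b = F.N n := by
  obtain ⟨n₀, h⟩ := (hF.colonFiltration ha).inter_right (F' := F.colonFiltration b)
  refine ⟨n₀ + 1, fun n hn => le_antisymm ?_ (le_inf
    (F.le_colonFiltration (Ideal.subset_span (by simp)) n)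
    (F.le_colonFiltration (Ideal.subset_span (by simp)) n))⟩
  obtain ⟨n, rfl⟩ : ∃ m, n = m + 1 := ⟨n - 1, by lia⟩
  -- By stability the intersection in degree `n + 1` is `(a, b)` times the one in degree `n`, and
  -- elements of the latter are carried into `M_{n+1}` by both `a` and `b`.
  refine (h n (by lia)).ge.trans (Submodule.smul_le.2 fun r hr x hx => ?_)
  obtain ⟨s, t, rfl⟩ := Ideal.mem_span_pair.1 hr
  rw [add_smul, mul_smul, mul_smul]
  exact add_mem (Submodule.smul_mem _ _ hx.1) (Submodule.smul_mem _ _ hx.2)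

end Ideal.Filtration

/-! ### The Hilbert series and the second Hilbert coefficient. -/

/-- If the first differences of `H` are eventually the constant `e`, the power series
`∑ H(n) Xⁿ` is the quotient of a polynomial by `(1 - X)²`. -/
theorem exists_polynomial_eq_one_sub_sq_mul_mk (H : ℕ → ℤ) (e : ℤ) (T : ℕ)
    (hT : ∀ n ≥ T, H (n + 1) = H n + e) :
    ∃ h : ℤ[X], (h : PowerSeries ℤ) = (1 - PowerSeries.X) ^ 2 * PowerSeries.mk H ∧
      (Polynomial.hasseDeriv 2 h).eval 1 =
        ∑ n ∈ Finset.range T, ((n : ℤ) + 1) * (e - (H (n + 1) - H n)) := by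
  obtain ⟨d, hd⟩ : ∃ d : ℕ → ℤ, ∀ n, e - (H (n + 1) - H n) = d n := ⟨_, fun _ => rfl⟩
  obtain ⟨d₀, hd₀⟩ : ∃ d₀, e - H 0 = d₀ := ⟨_, rfl⟩
  simp_rw [hd]
  -- `D` is the defect of `(1 - X) ∑ H(n) Xⁿ` from `e/(1 - X)`. Thus `h = e - (1 - X)D`, and
  -- `h''(1)/2 = D'(1)`.
  let D : ℤ[X] := C d₀ + ∑ n ∈ Finset.range T, monomial (n + 1) (d n)
  have hD : (1 - PowerSeries.X) * PowerSeries.mk H =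
      PowerSeries.C e * PowerSeries.mk 1 - (D : PowerSeries ℤ) := by
    ext n
    cases n with
    | zero => simp [D, sub_mul, Polynomial.finsetSum_coeff, Polynomial.coeff_monomial, ← hd₀]
    | succ n =>
      simp only [sub_mul, one_mul, map_sub, PowerSeries.coeff_mk, PowerSeries.coeff_succ_X_mul,
        PowerSeries.coeff_C_mul, Pi.one_apply, mul_one, Polynomial.coeff_coe, D,
        Polynomial.coeff_add, Polynomial.coeff_C_succ, Polynomial.finsetSum_coeff,
        Polynomial.coeff_monomial, add_left_inj, Finset.sum_ite_eq', Finset.mem_range, zero_add]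
      split_ifs with h
      · rw [← hd]
        ring
      · rw [hT n (by lia)]
        ring
  refine ⟨C e - (1 - X) * D, ?_, ?_⟩
  · rw [sq, mul_assoc, hD, mul_sub, mul_left_comm, mul_comm _ (PowerSeries.mk 1),
      PowerSeries.mk_one_mul_one_sub_eq_one]
    simp [-eq_intCast]
  · have key (n : ℕ) (r : ℤ) : (Polynomial.hasseDeriv 2 ((1 - X) * monomial (n + 1) r)).eval 1 =
        -((n + 1) * r) := by
      rw [sub_mul, one_mul, X_mul_monomial, map_sub, hasseDeriv_monomial, hasseDeriv_monomial]
      have h2 : (n + 1 + 1).choose 2 = n + 1 + (n + 1).choose 2 := by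
        rw [Nat.choose_succ_succ' (n + 1) 1, Nat.choose_one_right]
      simp only [eval_sub, eval_monomial, one_pow, mul_one, h2]
      push_cast
      ring
    have key0 (r : ℤ) : (Polynomial.hasseDeriv 2 ((1 - X) * C r)).eval 1 = 0 := by
      rw [sub_mul, one_mul, X_mul_C, map_sub, C_mul_X_eq_monomial, hasseDeriv_monomial,
        ← monomial_zero_left, hasseDeriv_monomial]
      simp
    rw [mul_add, Finset.mul_sum, map_sub, map_add, map_sum, eval_sub, eval_add, eval_finsetSum,
      key0, ← monomial_zero_left, hasseDeriv_monomial]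
    simp [key]

namespace Ideal.Filtration

variable {R M : Type*} [CommRing R] [AddCommGroup M] [Module R M] {I : Ideal R}

theorem isHPolynomial_hPolynomial_and_hilbertCoeff_two (hd : Module.natDim R M = 2)
    (F : I.Filtration M) {e : ℤ} {T : ℕ}
    (hT : ∀ n ≥ T, (F.hilbertFunction (n + 1) : ℤ) = F.hilbertFunction n + e) :
    F.IsHPolynomial F.hPolynomial ∧ F.hilbertCoeff 2 = ∑ n ∈ Finset.range T,
      ((n : ℤ) + 1) * (e - (F.hilbertFunction (n + 1) - F.hilbertFunction n)) := by
  obtain ⟨h, h₁, h₂⟩ := exists_polynomial_eq_one_sub_sq_mul_mk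
    (fun n => (F.hilbertFunction n : ℤ)) e T hT
  have hh : F.IsHPolynomial h := by
    rw [IsHPolynomial, hd]
    exact h₁
  have hF : F.IsHPolynomial F.hPolynomial := by
    have H : ∃ h, F.IsHPolynomial h := ⟨h, hh⟩
    rw [hPolynomial, dif_pos H]
    exact H.choose_spec
  refine ⟨hF, ?_⟩
  rw [hilbertCoeff, Polynomial.coe_injective ℤ (hF.trans hh.symm), h₂]

end Ideal.Filtration

/-! ### Consequences of positive depth of the associated graded module. -/

theorem Ideal.exists_isSMulRegular_of_depth_pos {A : Type*} [CommRing A] {I : Ideal A}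
    {N : Type*} [AddCommGroup N] [Module A N] (h : 0 < I.depth N) :
    ∃ r ∈ I, IsSMulRegular N r := by
  rw [Ideal.depth, lt_iSup_iff] at h
  obtain ⟨rs, h⟩ := h
  rw [lt_iSup_iff] at h
  obtain ⟨⟨hI, hreg⟩, hlen⟩ := h
  cases rs with
  | nil => simp at hlen
  | cons r rs =>
    exact ⟨r, hI r (by simp), ((RingTheory.Sequence.isWeaklyRegular_cons_iff N r rs).1 hreg).1⟩

namespace Ideal.Filtration

open IsLocalRing

variable {R M : Type*} [CommRing R] [IsLocalRing R] [AddCommGroup M] [Module R M] {I : Ideal R}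

/-- The class of `x` in degree `m` of `gr` is killed by a power of every element of the homogeneous
maximal ideal. Positive depth supplies a regular one, so the class is zero. -/
theorem mem_of_grDepth_pos {F : I.Filtration M} (hF : 0 < F.grDepth) {k : ℕ}
    (hk : maximalIdeal R ^ k ≤ I ⊔ Module.annihilator R M) {m : ℕ} {x : M} (hx : x ∈ F.N m)
    (hIx : ∀ r ∈ I, r • x ∈ F.N (m + 2)) : x ∈ F.N (m + 1) := by
  obtain ⟨r, hr, hreg⟩ := Ideal.exists_isSMulRegular_of_depth_pos hF
  obtain ⟨f, hf, rfl⟩ := (Ideal.mem_map_iff_of_surjective _ Ideal.Quotient.mk_surjective).1 hr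
  have hf0 : (f : R[X]).coeff 0 ∈ maximalIdeal R := hf
  have hs : PolynomialModule.single R m x ∈ F.submodule := by
    rw [mem_submodule]
    intro i
    rw [PolynomialModule.coeff_single, Finsupp.single_apply]
    split_ifs with h
    · exact h ▸ hx
    · exact zero_mem _
  have hfs : f ^ k • PolynomialModule.single R m x ∈ F.shift.submodule := by
    rw [mem_submodule]
    intro i
    rw [Subalgebra.smul_def, PolynomialModule.smul_single_apply]
    split_ifs with h
    · obtain ⟨j, rfl⟩ := Nat.exists_eq_add_of_le h
      rw [Nat.add_sub_cancel_left]
      cases j with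
      -- In degree zero, `f ^ k` has constant term in `𝔪^k`, and only its component in `I` acts on
      -- `x`.
      | zero =>
        have h0 : ((f ^ k : reesAlgebra I) : R[X]).coeff 0 = (f : R[X]).coeff 0 ^ k := by
          rw [SubmonoidClass.coe_pow, Polynomial.coeff_zero_eq_eval_zero, Polynomial.eval_pow,
            Polynomial.coeff_zero_eq_eval_zero]
        obtain ⟨s, hs, t, ht, hst⟩ := Submodule.mem_sup.1 (hk (Ideal.pow_mem_pow hf0 k))
        rw [h0, ← hst, add_smul, Module.mem_annihilator.1 ht, add_zero (s • x)]
        exact F.mono (m + 1) (hIx s hs)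
      | succ j =>
        have hle : I ^ (j + 1) • Submodule.span R {x} ≤ I ^ j • F.N (m + 2) := by
          rw [pow_succ, Submodule.mul_smul]
          refine smul_mono_right _ (Submodule.smul_le.2 fun r hr y hy => ?_)
          obtain ⟨s, rfl⟩ := Submodule.mem_span_singleton.1 hy
          rw [smul_comm]
          exact Submodule.smul_mem _ _ (hIx r hr)
        have := F.pow_smul_le j (m + 2) (hle (Submodule.smul_mem_smul ((f ^ k).2 (j + 1))
          (Submodule.mem_span_singleton_self x)))
        rwa [show j + (m + 2) = m + (j + 1) + 1 by ring] at this
    · exact zero_mem _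
  let y : F.gr := ⟨F.grMkQ (PolynomialModule.single R m x), _, hs, rfl⟩
  have hy : I.grRingMk f ^ k • y = 0 := by
    rw [← map_pow]
    refine Subtype.ext ?_
    change f ^ k • F.grMkQ (PolynomialModule.single R m x) = 0
    rw [← map_smul]
    exact (Submodule.Quotient.mk_eq_zero _).2 hfs
  have hy0 := congrArg Subtype.val ((hreg.pow k).right_eq_zero_of_smul hy)
  have := (mem_submodule _ _).1 ((Submodule.Quotient.mk_eq_zero F.shift.submodule).1 hy0) m
  rw [PolynomialModule.coeff_single, Finsupp.single_apply, if_pos rfl] at this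
  exact this

theorem colonElem_inf_le_of_grDepth_pos {a b : R} {F : (Ideal.span {a, b}).Filtration M}
    (h0 : F.N 0 = ⊤) (hF : 0 < F.grDepth) {k : ℕ}
    (hk : maximalIdeal R ^ k ≤ Ideal.span {a, b} ⊔ Module.annihilator R M) (n : ℕ) :
    (F.N (n + 1)).colonElem a ⊓ (F.N (n + 1)).colonElem b ≤ F.N n := by
  intro x hx
  have key (m : ℕ) (hm : m ≤ n) : x ∈ F.N m := by
    induction m with
    | zero => simp [h0]
    | succ m ih =>
      refine mem_of_grDepth_pos hF hk (ih (by lia)) fun r hr =>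
        F.antitone (by lia : m + 2 ≤ n + 1) ?_
      obtain ⟨s, t, rfl⟩ := Ideal.mem_span_pair.1 hr
      rw [add_smul, mul_smul, mul_smul]
      exact add_mem (Submodule.smul_mem _ _ hx.1) (Submodule.smul_mem _ _ hx.2)
  exact key n le_rfl

theorem mem_of_grDepth_pos_of_pow {F : I.Filtration M} (hF : 0 < F.grDepth) {k : ℕ}
    (hk : maximalIdeal R ^ k ≤ I ⊔ Module.annihilator R M) {m : ℕ} {x : M} (hx : x ∈ F.N m)
    (p : ℕ) (hIx : ∀ r ∈ I ^ p, r • x ∈ F.N (m + p + 1)) : x ∈ F.N (m + 1) := by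
  induction p with
  | zero => simpa using hIx 1 (by simp)
  | succ p ih =>
    refine ih fun s hs => mem_of_grDepth_pos hF hk ?_ fun r hr => ?_
    · rw [add_comm]
      exact F.pow_smul_le p m (Submodule.smul_mem_smul hs hx)
    · rw [smul_smul]
      exact hIx _ (pow_succ' I p ▸ Ideal.mul_mem_mul hr hs)

theorem IsSuperficial.colonElem_le_of_grDepth_pos {F : I.Filtration M}
    (h0 : F.N 0 = ⊤) (hF : 0 < F.grDepth) {k : ℕ}
    (hk : maximalIdeal R ^ k ≤ I ⊔ Module.annihilator R M) {a : R} (ha : F.IsSuperficial a)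
    (n : ℕ) : (F.N (n + 1)).colonElem a ≤ F.N n := by
  obtain ⟨-, c, hc⟩ := ha
  intro x hx
  rw [Submodule.mem_colonElem] at hx
  -- The superficial condition only controls elements of `M_c`, so `x` is first multiplied by `I^c`;
  -- positive depth then removes that factor.
  have key (m : ℕ) (hm : m ≤ n) : x ∈ F.N m := by
    induction m with
    | zero => simp [h0]
    | succ m ih =>
      refine mem_of_grDepth_pos_of_pow hF hk (ih (by lia)) c fun r hr => ?_
      rw [← hc _ (by lia)]
      refine ⟨?_, F.antitone (by lia)
        (F.pow_smul_le c m (Submodule.smul_mem_smul hr (ih (by lia))))⟩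
      rw [SetLike.mem_coe, Submodule.mem_colonElem, smul_comm]
      exact F.antitone (by lia)
        (F.pow_smul_le c (n + 1) (Submodule.smul_mem_smul hr hx))
  exact key n le_rfl

end Ideal.Filtration

/-! ### Infinite sums in `ℕ∞` and the passage to `EReal`. -/

theorem ENat.tsum_pnat_eq_sum_range {f : ℕ → ℕ} {T : ℕ} (hT : ∀ n > T, f n = 0) :
    ∑' n : ℕ+, (f n : ℕ∞) = ((∑ n ∈ Finset.range T, f (n + 1) : ℕ) : ℕ∞) := by
  rw [tsum_pnat_eq_tsum_succ (f := fun n => (f n : ℕ∞)), tsum_eq_sum (s := Finset.range T)]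
  · push_cast
    rfl
  · intro n hn
    rw [hT (n + 1) (by simpa using hn), Nat.cast_zero]

theorem ENat.exists_forall_ge_eq_zero_of_tsum_pnat_ne_top {f : ℕ → ℕ}
    (h : ∑' n : ℕ+, (f n : ℕ∞) ≠ ⊤) : ∃ T, ∀ n ≥ T, f n = 0 := by
  rw [tsum_pnat_eq_tsum_succ (f := fun n => (f n : ℕ∞)),
    (hasSum_of_isLUB _ isLUB_iSup).tsum_eq] at h
  obtain ⟨K, hK⟩ := ENat.ne_top_iff_exists.1 h
  by_contra! hne
  have hinf : {n | f (n + 1) ≠ 0}.Infinite := by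
    refine Set.infinite_of_not_bddAbove fun ⟨B, hB⟩ => ?_
    obtain ⟨n, hn, hn0⟩ := hne (B + 2)
    have : n - 1 ≤ B := hB (show f (n - 1 + 1) ≠ 0 by rwa [Nat.sub_add_cancel (by lia)])
    lia
  -- A sum equal to `K` cannot have `K + 1` terms that are each at least one.
  obtain ⟨s, hs, hcard⟩ := hinf.exists_subset_card_eq (K + 1)
  have h1 : ((∑ n ∈ s, f (n + 1) : ℕ) : ℕ∞) ≤ K := by
    rw [hK]
    push_cast
    exact le_iSup (fun s : Finset ℕ => ∑ n ∈ s, (f (n + 1) : ℕ∞)) s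
  have h2 : s.card • 1 ≤ ∑ n ∈ s, f (n + 1) :=
    Finset.card_nsmul_le_sum _ _ _ fun n hn => Nat.one_le_iff_ne_zero.2 (hs hn)
  have h3 := ENat.natCast_le_natCast.1 h1
  rw [hcard] at h2
  simp only [smul_eq_mul, mul_one] at h2
  lia

theorem EReal.intCast_le_natCast_ennreal {z : ℤ} {m : ℕ} (h : z ≤ m) :
    ((z : ℝ) : EReal) ≤ (((m : ℕ∞) : ENNReal) : EReal) := by
  have h' : (z : ℝ) ≤ ((m : NNReal) : ℝ) := by
    simpa using (Int.cast_le (R := ℝ)).2 h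
  rw [ENat.toENNReal_coe, ← ENNReal.coe_natCast, EReal.coe_nnreal_eq_coe_real]
  exact EReal.coe_le_coe_iff.2 h'

/-! ### Differences of Hilbert functions. -/

namespace Ideal.Filtration

open IsLocalRing Submodule

variable {R M : Type*} [CommRing R] [IsLocalRing R] [IsNoetherianRing R] [AddCommGroup M]
  [Module R M] [Module.Finite R M]

theorem exists_length_quotient_eq {I : Ideal R} {F : I.Filtration M} (h0 : F.N 0 = ⊤) {k : ℕ}
    (hk : maximalIdeal R ^ k ≤ I ⊔ Module.annihilator R M) :
    ∃ L : ℕ → ℕ, (∀ n, Module.length R (M ⧸ F.N n) = L n) ∧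
      ∀ n, (L (n + 1) : ℤ) = F.hilbertFunction n + L n := by
  have hL (n : ℕ) := ENat.ne_top_iff_exists.1
    (length_quotient_ne_top_of_pow_smul_le hk (pow_smul_top_le h0 n))
  choose L hL using hL
  refine ⟨L, fun n => (hL n).symm, fun n => ?_⟩
  have h1 := length_quotient_eq_relLength_add (F.mono n)
  have h2 : (F.N n).relLength (F.N (n + 1)) = F.hilbertFunction n := by
    refine (ENat.natCast_toNat fun h => ENat.natCast_ne_top (L (n + 1)) ?_).symm
    rw [hL, h1, h, top_add]
  rw [h2, ← hL, ← hL] at h1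
  exact_mod_cast h1

/-- Second differences of the length function of a filtration, through the Koszul complex. -/
theorem hilbertFunction_succ_sub_eq {a b : R} {F : (Ideal.span {a, b}).Filtration M}
    (h0 : F.N 0 = ⊤) {k : ℕ}
    (hk : maximalIdeal R ^ k ≤ Ideal.span {a, b} ⊔ Module.annihilator R M) {c : ℕ}
    (hc : Module.length R (M ⧸ (Ideal.span {a, b} • ⊤ : Submodule R M)) = c) :
    ∃ v u w : ℕ → ℕ,
      (∀ n, (F.N (n + 1)).relLength (Ideal.span {a, b} • F.N n) = v n) ∧
      (∀ n, ((F.N (n + 1)).colonElem a ⊓ (F.N (n + 1)).colonElem b).relLength (F.N n) = u n) ∧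
      (∀ n, (pairSyzygies R M a b ⊔ (F.N n).prod (F.N n)).relLength
        (koszulSyzygies R M a b ⊔ (F.N n).prod (F.N n)) = w n) ∧
      ∀ n, (F.hilbertFunction (n + 1) : ℤ) - F.hilbertFunction n =
        c + u n - w (n + 1) - v (n + 1) := by
  have hfin {n : ℕ} {X : Submodule R M} (hX : F.N n ≤ X) : Module.length R (M ⧸ X) ≠ ⊤ :=
    length_quotient_ne_top_of_pow_smul_le hk ((pow_smul_top_le h0 n).trans hX)
  obtain ⟨L, hL, hH⟩ := exists_length_quotient_eq h0 hk
  have hle (n : ℕ) : F.N n ≤ (F.N (n + 1)).colonElem a ⊓ (F.N (n + 1)).colonElem b :=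
    le_inf (F.le_colonFiltration (Ideal.subset_span (by simp)) n)
      (F.le_colonFiltration (Ideal.subset_span (by simp)) n)
  have hW (n : ℕ) := ENat.ne_top_iff_exists.1 (hfin (hle n))
  choose W hW using hW
  have hu (n : ℕ) : ∃ u : ℕ, (u : ℕ∞) =
      ((F.N (n + 1)).colonElem a ⊓ (F.N (n + 1)).colonElem b).relLength (F.N n) := by
    refine ENat.ne_top_iff_exists.1 fun h => ENat.natCast_ne_top (L n) ?_
    rw [← hL, length_quotient_eq_relLength_add (hle n), h, top_add]
  choose u hu using hu
  have hJ (n : ℕ) : ∃ l : ℕ, (l : ℕ∞) =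
      Module.length R (M ⧸ (Ideal.span {a, b} • F.N n : Submodule R M)) := by
    refine ENat.ne_top_iff_exists.1 (length_quotient_ne_top_of_pow_smul_le hk (n := n + 1) ?_)
    rw [pow_succ', Submodule.mul_smul]
    exact smul_mono_right _ (pow_smul_top_le h0 n)
  choose LJ hLJ using hJ
  have hv (n : ℕ) : ∃ v : ℕ, (v : ℕ∞) =
      (F.N (n + 1)).relLength (Ideal.span {a, b} • F.N n) := by
    refine ENat.ne_top_iff_exists.1 fun h => ENat.natCast_ne_top (LJ n) ?_
    rw [hLJ, length_quotient_eq_relLength_add (F.smul_le n), h, top_add]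
  choose v hv using hv
  have hw (n : ℕ) : ∃ w : ℕ, (w : ℕ∞) =
      (pairSyzygies R M a b ⊔ (F.N n).prod (F.N n)).relLength
        (koszulSyzygies R M a b ⊔ (F.N n).prod (F.N n)) := by
    refine ENat.ne_top_iff_exists.1 (ne_top_of_le_ne_top ?_ (relLength_sup_le _ _ _))
    refine relLength_ne_top_of_smul_le hk (fun r hr x => ?_)
      fun r hr x hx => smul_mem_koszulSyzygies hx hr
    exact Prod.ext (Module.mem_annihilator.1 hr _) (Module.mem_annihilator.1 hr _)
  choose w hw using hw
  refine ⟨v, u, w, fun n => (hv n).symm, fun n => (hu n).symm, fun n => (hw n).symm, fun n => ?_⟩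
  have e₁ := two_mul_length_quotient_add a b (F.N (n + 1))
  have e₂ := length_quotient_eq_relLength_add (hle n)
  have e₃ := length_quotient_eq_relLength_add (F.smul_le (n + 1))
  rw [hL, hc, ← hW, ← hw, ← hLJ] at e₁
  rw [hL, ← hW, ← hu] at e₂
  rw [hL, ← hLJ, ← hv] at e₃
  have e₁' : 2 * L (n + 1) + c = W n + w (n + 1) + LJ (n + 1) := by exact_mod_cast e₁
  have e₂' : L n = u n + W n := by exact_mod_cast e₂
  have e₃' : LJ (n + 1) = v (n + 1) + L (n + 1 + 1) := by exact_mod_cast e₃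
  have := hH n
  have := hH (n + 1)
  lia

end Ideal.Filtration

namespace Ideal.Filtration

open IsLocalRing Submodule

variable {R M : Type*} [CommRing R] [IsLocalRing R] [IsNoetherianRing R] [AddCommGroup M]
  [Module R M] [Module.Finite R M]

/-- Differences of the Hilbert function of a filtration, through multiplication by `a` on `M`
and by `b` on `M / aM`. -/
theorem hilbertFunction_succ_sub_eq_colonElem {a b : R} {F : (Ideal.span {a, b}).Filtration M}
    (h0 : F.N 0 = ⊤) {k : ℕ}
    (hk : maximalIdeal R ^ k ≤ Ideal.span {a, b} ⊔ Module.annihilator R M) {c : ℕ}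
    (hc : Module.length R (M ⧸ (Ideal.span {a, b} • ⊤ : Submodule R M)) = c)
    {A P : Submodule R M} (hA : A = (⊤ : Submodule R M).map (LinearMap.lsmul R M a))
    (hP : P = A.colonElem b) :
    ∃ v w s : ℕ → ℕ,
      (∀ n, (F.N (n + 1) ⊔ A).relLength (Ideal.span {a, b} • F.N n ⊔ A) = v n) ∧
      (∀ n, (P ⊔ F.N n).relLength (A ⊔ F.N n) = w n) ∧
      (∀ n, ((F.N (n + 1)).colonElem a).relLength (F.N n) = s n) ∧
      ∀ n, (F.hilbertFunction (n + 1) : ℤ) - F.hilbertFunction n =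
        c - v (n + 1) - w (n + 1) - s (n + 1) + s n := by
  have hfin {n : ℕ} {X : Submodule R M} (hX : F.N n ≤ X) :
      ∃ l : ℕ, (l : ℕ∞) = Module.length R (M ⧸ X) := ENat.ne_top_iff_exists.1
    (length_quotient_ne_top_of_pow_smul_le hk ((pow_smul_top_le h0 n).trans hX))
  have hrel {X Y : Submodule R M} (hXY : X ≤ Y) {l : ℕ} (hl : (l : ℕ∞) = Module.length R (M ⧸ X)) :
      ∃ r : ℕ, (r : ℕ∞) = Y.relLength X := by
    refine ENat.ne_top_iff_exists.1 fun h => ENat.natCast_ne_top l ?_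
    rw [hl, length_quotient_eq_relLength_add hXY, h, top_add]
  obtain ⟨L, hL, hH⟩ := exists_length_quotient_eq h0 hk
  have hle (n : ℕ) : F.N n ≤ (F.N (n + 1)).colonElem a :=
    F.le_colonFiltration (Ideal.subset_span (by simp)) n
  have hAP : A ≤ P := by
    rw [hP]
    intro x hx
    exact A.smul_mem b hx
  have hJle (n : ℕ) : Ideal.span {a, b} • F.N n ⊔ A ≤ F.N (n + 1) ⊔ A :=
    sup_le_sup_right (F.smul_le n) A
  choose C hC using fun n => hfin (hle n)
  choose s hs using fun n => hrel (hle n) (hL n).symm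
  choose X hX using fun n => hfin (le_sup_left : F.N n ≤ F.N n ⊔ A)
  choose Y hY using fun n => hfin (le_sup_left : F.N n ≤ F.N n ⊔ P)
  have hZ (n : ℕ) : ((Y n + c : ℕ) : ℕ∞) =
      Module.length R (M ⧸ Ideal.span {a, b} • F.N n ⊔ A) := by
    rw [hA, length_quotient_span_pair_smul_sup, hc, ← hA, ← hP, ← hY, Nat.cast_add]
  choose v hv using fun n => hrel (hJle n) (hZ n)
  choose w hw using fun n => hrel (sup_le_sup_right hAP (F.N n)) (sup_comm A (F.N n) ▸ hX n)
  refine ⟨v, w, s, fun n => (hv n).symm, fun n => (hw n).symm, fun n => (hs n).symm, fun n => ?_⟩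
  -- `L`, `C`, `X`, `Y` are the lengths of `M` modulo `F_n`, `(F_{n+1} : a)`, `F_n + aM` and `F_n +
  -- (aM : b)`; eliminating `C`, `X`, `Y` leaves the second difference of `L`.
  have e₁ (n : ℕ) : L (n + 1) = C n + X (n + 1) := by
    have := length_quotient_eq_colonElem_add a (F.N (n + 1))
    rw [hL, ← hC, ← hA, ← hX] at this
    exact_mod_cast this
  have e₂ (n : ℕ) : L n = s n + C n := by
    have := length_quotient_eq_relLength_add (hle n)
    rw [hL, ← hC, ← hs] at this
    exact_mod_cast this
  have e₃ : Y (n + 1) + c = v (n + 1) + X (n + 1 + 1) := by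
    have := length_quotient_eq_relLength_add (hJle (n + 1))
    rw [← hZ, ← hX, ← hv] at this
    exact_mod_cast this
  have e₄ : X (n + 1) = w (n + 1) + Y (n + 1) := by
    have := length_quotient_eq_relLength_add (sup_le_sup_right hAP (F.N (n + 1)))
    rw [← hw, sup_comm A, sup_comm P, ← hX, ← hY] at this
    exact_mod_cast this
  have := e₁ n
  have := e₁ (n + 1)
  have := e₂ n
  have := e₂ (n + 1)
  have := hH n
  have := hH (n + 1)
  lia

/-- The Hilbert functions of two good filtrations grow linearly with the same slope. -/
theorem exists_hilbertFunction_succ_eq {a b : R} (ha : IsSMulRegular M a) {k : ℕ}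
    (hk : maximalIdeal R ^ k ≤ Ideal.span {a, b} ⊔ Module.annihilator R M)
    {F G : (Ideal.span {a, b}).Filtration M} (hF : F.IsGood) (hG : G.IsGood) :
    ∃ (e : ℤ) (T : ℕ), (∀ n ≥ T, (F.hilbertFunction (n + 1) : ℤ) = F.hilbertFunction n + e) ∧
      ∀ n ≥ T, (G.hilbertFunction (n + 1) : ℤ) = G.hilbertFunction n + e := by
  obtain ⟨c, hc⟩ := ENat.ne_top_iff_exists.1 (length_quotient_ne_top_of_pow_smul_le (M := M) hk
    (n := 1) (X := Ideal.span {a, b} • ⊤) (by rw [pow_one]))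
  have hfin : (pairSyzygies R M a b).relLength (koszulSyzygies R M a b) ≠ ⊤ := by
    refine relLength_ne_top_of_smul_le hk (fun r hr x => ?_)
      fun r hr x hx => smul_mem_koszulSyzygies hx hr
    exact Prod.ext (Module.mem_annihilator.1 hr _) (Module.mem_annihilator.1 hr _)
  obtain ⟨K, hK⟩ := ENat.ne_top_iff_exists.1 hfin
  have main {F : (Ideal.span {a, b}).Filtration M} (hF : F.IsGood) : ∃ W T : ℕ, ∀ n ≥ T,
      (F.hilbertFunction (n + 1) : ℤ) = F.hilbertFunction n + (c - W) ∧
      (pairSyzygies R M a b ⊔ (F.N n).prod (F.N n)).relLength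
        (koszulSyzygies R M a b ⊔ (F.N n).prod (F.N n)) = W := by
    obtain ⟨v, u, w, hv, hu, hw, h⟩ := hilbertFunction_succ_sub_eq hF.1 hk hc.symm
    -- The `w n` increase as `F_n` shrinks and are bounded by the finite length of the Koszul
    -- homology, so they stabilize; `u` and `v` eventually vanish, leaving slope `c - W`.
    have hmono : Monotone w := monotone_nat_of_le_succ fun n => by
      rw [← ENat.natCast_le_natCast, ← hw, ← hw]
      exact relLength_sup_anti _ _ (Submodule.prod_mono (F.mono n) (F.mono n))
    have hbdd (n : ℕ) : w n ≤ K := by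
      rw [← ENat.natCast_le_natCast, ← hw, hK]
      exact relLength_sup_le _ _ _
    obtain ⟨W, T₁, h₁⟩ := converges_of_monotone_of_bounded hmono hbdd
    obtain ⟨T₂, h₂⟩ := hF.2
    obtain ⟨T₃, h₃⟩ := hF.2.exists_colonElem_inf_eq ha
    refine ⟨W, T₁ + T₂ + T₃, fun n hn => ⟨?_, ?_⟩⟩
    · have hv0 : v (n + 1) = 0 := by
        have := hv (n + 1)
        rw [h₂ (n + 1) (by lia), relLength_eq_zero le_rfl] at this
        exact_mod_cast this.symm
      have hu0 : u n = 0 := by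
        have := hu n
        rw [h₃ n (by lia), relLength_eq_zero le_rfl] at this
        exact_mod_cast this.symm
      have := h n
      rw [hv0, hu0, h₁ (n + 1) (by lia)] at this
      push_cast at this
      linarith
    · rw [hw, h₁ n (by lia)]
  obtain ⟨W₁, T₁, h₁⟩ := main hF
  obtain ⟨W₂, T₂, h₂⟩ := main hG
  -- Each filtration shifted by `d` lies inside the other, so the two limits of `w` bound each
  -- other.
  obtain ⟨d, hd⟩ := hF.2.bounded_difference hG.2 (hF.1.trans hG.1.symm)
  have hle₁ : (W₁ : ℕ∞) ≤ W₂ := by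
    rw [← (h₁ (T₁ + T₂) (by lia)).2, ← (h₂ (T₁ + T₂ + d) (by lia)).2]
    exact relLength_sup_anti _ _ (Submodule.prod_mono (hd _).2 (hd _).2)
  have hle₂ : (W₂ : ℕ∞) ≤ W₁ := by
    rw [← (h₂ (T₁ + T₂) (by lia)).2, ← (h₁ (T₁ + T₂ + d) (by lia)).2]
    exact relLength_sup_anti _ _ (Submodule.prod_mono (hd _).1 (hd _).1)
  have hW : W₁ = W₂ := by exact_mod_cast le_antisymm hle₁ hle₂
  subst hW
  exact ⟨c - W₁, T₁ + T₂, fun n hn => (h₁ n (by lia)).1, fun n hn => (h₂ n (by lia)).1⟩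

end Ideal.Filtration

/-! ### Comparison of two nested filtrations. -/

namespace Ideal.Filtration

open IsLocalRing Submodule

/-- An `I`-filtration, as a `J`-filtration for a smaller ideal `J`. -/
def ofLE {R M : Type*} [CommRing R] [AddCommGroup M] [Module R M] {I J : Ideal R}
    (F : I.Filtration M) (h : J ≤ I) : J.Filtration M where
  N := F.N
  mono := F.mono
  smul_le n := (Submodule.smul_mono_left h).trans (F.smul_le n)

variable {R M : Type*} [CommRing R] [IsLocalRing R] [IsNoetherianRing R] [AddCommGroup M]
  [Module R M] [Module.Finite R M]

/-- In the Koszul count `u` vanishes for `G` and is nonnegative for `F`, while `w` is at least as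
large for the smaller filtration `G`. -/
theorem hilbertFunction_sub_le {a b : R} {k : ℕ}
    (hk : maximalIdeal R ^ k ≤ Ideal.span {a, b} ⊔ Module.annihilator R M)
    {F G : (Ideal.span {a, b}).Filtration M} (hF : F.N 0 = ⊤) (hG : G.N 0 = ⊤)
    (hGF : ∀ n, G.N n ≤ F.N n)
    (hcolon : ∀ n, (G.N (n + 1)).colonElem a ⊓ (G.N (n + 1)).colonElem b ≤ G.N n) {v : ℕ → ℕ}
    (hv : ∀ n, (F.N (n + 1)).relLength (Ideal.span {a, b} • F.N n) = v n) (n : ℕ) :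
    ((G.hilbertFunction (n + 1) : ℤ) - G.hilbertFunction n) -
      (F.hilbertFunction (n + 1) - F.hilbertFunction n) ≤ v (n + 1) := by
  obtain ⟨c, hc⟩ := ENat.ne_top_iff_exists.1 (length_quotient_ne_top_of_pow_smul_le (M := M) hk
    (n := 1) (X := Ideal.span {a, b} • ⊤) (by rw [pow_one]))
  obtain ⟨v₁, u₁, w₁, hv₁, -, hw₁, h₁⟩ := hilbertFunction_succ_sub_eq hF hk hc.symm
  obtain ⟨v₂, u₂, w₂, -, hu₂, hw₂, h₂⟩ := hilbertFunction_succ_sub_eq hG hk hc.symm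
  have hvv : v (n + 1) = v₁ (n + 1) := by
    exact_mod_cast (hv (n + 1)).symm.trans (hv₁ (n + 1))
  have hu0 : u₂ n = 0 := by
    exact_mod_cast (hu₂ n).symm.trans (relLength_eq_zero (hcolon n))
  have hww : w₁ (n + 1) ≤ w₂ (n + 1) := by
    rw [← ENat.natCast_le_natCast, ← hw₁, ← hw₂]
    exact relLength_sup_anti _ _ (Submodule.prod_mono (hGF _) (hGF _))
  rw [h₁, h₂]
  lia

/-- The counterpart with no condition on the colons of `G`: their failure enters through
differences, so that it can be summed by parts. -/
theorem hilbertFunction_sub_le_add_colonElem {a b : R} {k : ℕ}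
    (hk : maximalIdeal R ^ k ≤ Ideal.span {a, b} ⊔ Module.annihilator R M)
    {F G : (Ideal.span {a, b}).Filtration M} (hF : F.N 0 = ⊤) (hG : G.N 0 = ⊤)
    (hGF : ∀ n, G.N n ≤ F.N n) {v : ℕ → ℕ}
    (hv : ∀ n, (F.N (n + 1)).relLength (Ideal.span {a, b} • F.N n) = v n) :
    ∃ s t : ℕ → ℕ, (∀ n, ((F.N (n + 1)).colonElem a).relLength (F.N n) = s n) ∧
      (∀ n, ((G.N (n + 1)).colonElem a).relLength (G.N n) = t n) ∧
      ∀ n, ((G.hilbertFunction (n + 1) : ℤ) - G.hilbertFunction n) -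
        (F.hilbertFunction (n + 1) - F.hilbertFunction n) ≤
          v (n + 1) + (s (n + 1) - s n) - (t (n + 1) - t n) := by
  obtain ⟨c, hc⟩ := ENat.ne_top_iff_exists.1 (length_quotient_ne_top_of_pow_smul_le (M := M) hk
    (n := 1) (X := Ideal.span {a, b} • ⊤) (by rw [pow_one]))
  obtain ⟨v₁, w₁, s, hv₁, hw₁, hs, h₁⟩ :=
    hilbertFunction_succ_sub_eq_colonElem hF hk hc.symm rfl rfl
  obtain ⟨v₂, w₂, t, -, hw₂, ht, h₂⟩ :=
    hilbertFunction_succ_sub_eq_colonElem hG hk hc.symm rfl rfl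
  refine ⟨s, t, hs, ht, fun n => ?_⟩
  have hvv : v₁ (n + 1) ≤ v (n + 1) := by
    rw [← ENat.natCast_le_natCast, ← hv₁, ← hv]
    exact relLength_sup_le _ _ _
  have hww : w₁ (n + 1) ≤ w₂ (n + 1) := by
    rw [← ENat.natCast_le_natCast, ← hw₁, ← hw₂]
    exact relLength_sup_anti _ _ (hGF _)
  rw [h₁, h₂]
  lia

theorem sum_succ_mul_sub (s : ℕ → ℤ) (T : ℕ) :
    ∑ n ∈ Finset.range T, ((n : ℤ) + 1) * (s (n + 1) - s n) =
      T * s T - ∑ n ∈ Finset.range T, s n := by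
  induction T with
  | zero => simp
  | succ T ih =>
    rw [Finset.sum_range_succ, Finset.sum_range_succ, ih]
    push_cast
    ring

end Ideal.Filtration

/-! ### The main theorem. -/

theorem mainTheorem4 {R : Type*} [CommRing R] [IsLocalRing R] [IsNoetherianRing R]
    [Infinite (IsLocalRing.ResidueField R)]
    {M : Type*} [AddCommGroup M] [Module R M] [Module.Finite R M]
    (hdim : Module.supportDim R M = 2)
    (hdepth : 0 < (IsLocalRing.maximalIdeal R).depth M)
    (q : Ideal R) (hq : q.radical = IsLocalRing.maximalIdeal R)
    (F : q.Filtration M) (hF : F.IsGood)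
    (a₁ a₂ : R) (ha : F.IsSuperficialSeq ![a₁, a₂])
    (J : Ideal R) (hJ : J = Ideal.span {a₁, a₂})
    -- the `J`-adic filtration `{Jⁿ M}`
    (N : J.Filtration M) (hN : N = J.stableFiltration ⊤)
    -- the two sums of lengths
    (S₁ S₂ : ℕ∞)
    (hS₁ : S₁ = ∑' n : ℕ+, ((n : ℕ) : ℕ∞) *
      (F.N ((n : ℕ) + 1)).relLength (J • F.N (n : ℕ)))
    (hS₂ : S₂ = ∑' n : ℕ+,
      ((J ^ ((n : ℕ) + 1) • (⊤ : Submodule R M)).colonElem a₁).relLength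
        (J ^ (n : ℕ) • (⊤ : Submodule R M))) :
    -- the Hilbert coefficients of both filtrations are defined, and the first sum is finite
    F.IsHPolynomial F.hPolynomial ∧ N.IsHPolynomial N.hPolynomial ∧ S₁ ≠ ⊤ ∧
    -- the bound, which needs nothing on `gr_N(M)`
    (((F.hilbertCoeff 2 - N.hilbertCoeff 2 : ℤ) : ℝ) : EReal) ≤
      (((S₁ + S₂ : ℕ∞) : ENNReal) : EReal) ∧
    -- if `a₁, a₂` is moreover superficial for the `J`-adic filtration, the second sum is finite,
    -- and it vanishes if `gr_N(M)` has positive depth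
    (N.IsSuperficialSeq ![a₁, a₂] → S₂ ≠ ⊤ ∧ (0 < N.grDepth → S₂ = 0)) ∧
    -- if `gr_N(M)` has positive depth, the bound holds without the second sum
    (0 < N.grDepth →
      (((F.hilbertCoeff 2 - N.hilbertCoeff 2 : ℤ) : ℝ) : EReal) ≤
        ((S₁ : ENNReal) : EReal)) := by
  subst hJ hN
  have hdim' : Module.supportDim R M ≤ 2 := hdim.le
  have hd : Module.natDim R M = 2 := by
    rw [Module.natDim, hdim]
    rfl
  have hqm : q ≤ IsLocalRing.maximalIdeal R := hq ▸ Ideal.le_radical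
  have hqtop : q ≠ ⊤ := fun e =>
    (IsLocalRing.maximalIdeal.isMaximal R).ne_top (top_le_iff.1 (e ▸ hqm))
  obtain ⟨r, hr, hrM⟩ := Ideal.exists_isSMulRegular_of_depth_pos hdepth
  have hreg : IsSMulRegular M a₁ :=
    ha.isSuperficial_fst.isSMulRegular hF hqtop (hq ▸ hr) hrM
  obtain ⟨k, hk⟩ := ha.exists_maximalIdeal_pow_le hdim' hq hF
  obtain ⟨n₀, hn₀⟩ := ha.exists_smul_eq hdim' hq hF
  obtain ⟨n₁, hn₁⟩ := ha.isSuperficial_fst.exists_colonElem_eq hF hreg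
  have hJq : Ideal.span {a₁, a₂} ≤ q := by
    rw [Ideal.span_le, Set.pair_subset_iff]
    exact ⟨ha.isSuperficial_fst.1, ha.isSuperficial_snd.1⟩
  set N : (Ideal.span {a₁, a₂}).Filtration M := (Ideal.span {a₁, a₂}).stableFiltration ⊤ with hN
  have hNgood : N.IsGood := ⟨by simp [hN], Ideal.stableFiltration_stable _ _⟩
  -- The same submodules viewed as a `J`-filtration, so the Hilbert function is unchanged; it is
  -- good because `J` is a reduction.
  let F' : (Ideal.span {a₁, a₂}).Filtration M := F.ofLE hJq
  have hF' : F'.IsGood := ⟨hF.1, n₀, hn₀⟩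
  have hNF (n : ℕ) : N.N n ≤ F'.N n := Ideal.Filtration.pow_smul_top_le hF'.1 n
  obtain ⟨e, T, hT₁, hT₂⟩ := Ideal.Filtration.exists_hilbertFunction_succ_eq hreg hk hF' hNgood
  obtain ⟨c, hc⟩ := ENat.ne_top_iff_exists.1 (length_quotient_ne_top_of_pow_smul_le (M := M) hk
    (n := 1) (X := Ideal.span {a₁, a₂} • ⊤) (by rw [pow_one]))
  obtain ⟨v, -, -, hv, -⟩ := Ideal.Filtration.hilbertFunction_succ_sub_eq hF'.1 hk hc.symm
  have hv0 (n : ℕ) (hn : n ≥ n₀) : v n = 0 := by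
    have := hv n
    rw [show Ideal.span {a₁, a₂} • F'.N n = F'.N (n + 1) from hn₀ n hn,
      Submodule.relLength_eq_zero le_rfl] at this
    exact_mod_cast this.symm
  have hS₁' (B : ℕ) (hB : n₀ ≤ B) :
      S₁ = ((∑ n ∈ Finset.range B, (n + 1) * v (n + 1) : ℕ) : ℕ∞) := by
    rw [hS₁, ← ENat.tsum_pnat_eq_sum_range (f := fun n => n * v n)
      fun n hn => by simp [hv0 n (by lia)]]
    refine tsum_congr fun n => ?_
    rw [Nat.cast_mul, ← hv]
    rfl
  have he₂ (B : ℕ) (hB : T ≤ B) : F.hilbertCoeff 2 - N.hilbertCoeff 2 =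
      ∑ n ∈ Finset.range B, ((n : ℤ) + 1) *
        (((N.hilbertFunction (n + 1) : ℤ) - N.hilbertFunction n) -
          (F'.hilbertFunction (n + 1) - F'.hilbertFunction n)) := by
    rw [(F.isHPolynomial_hPolynomial_and_hilbertCoeff_two hd fun n hn => hT₁ n (hB.trans hn)).2,
      (N.isHPolynomial_hPolynomial_and_hilbertCoeff_two hd fun n hn => hT₂ n (hB.trans hn)).2,
      ← Finset.sum_sub_distrib]
    refine Finset.sum_congr rfl fun n _ => ?_
    change _ = ((n : ℤ) + 1) * (((N.hilbertFunction (n + 1) : ℤ) - N.hilbertFunction n) -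
      (F.hilbertFunction (n + 1) - F.hilbertFunction n))
    ring
  obtain ⟨s, t, hs, ht, hst⟩ :=
    Ideal.Filtration.hilbertFunction_sub_le_add_colonElem hk hF'.1 hNgood.1 hNF hv
  have hS₂' : S₂ = ∑' n : ℕ+, (t n : ℕ∞) := hS₂.trans (tsum_congr fun n => ht n)
  have ht0 : t 0 = 0 := by
    have := ht 0
    rw [hNgood.1, Submodule.relLength_eq_zero le_top] at this
    exact_mod_cast this.symm
  refine ⟨(F.isHPolynomial_hPolynomial_and_hilbertCoeff_two hd hT₁).1,
    (N.isHPolynomial_hPolynomial_and_hilbertCoeff_two hd hT₂).1, ?_, ?_, fun hNs => ⟨?_, fun hgr =>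
    ?_⟩, fun hgr => ?_⟩
  · rw [hS₁' n₀ le_rfl]
    exact ENat.natCast_ne_top _
  -- If the second sum is finite, its terms eventually vanish, and `B` can be chosen beyond every
  -- threshold so that no boundary term survives summation by parts.
  · by_cases htop : S₂ = ⊤
    · simp [htop]
    obtain ⟨T', hT'⟩ := ENat.exists_forall_ge_eq_zero_of_tsum_pnat_ne_top (hS₂' ▸ htop)
    have hB : ∃ B, T ≤ B ∧ n₀ ≤ B ∧ n₁ ≤ B ∧ T' ≤ B := ⟨T + n₀ + n₁ + T', by lia⟩
    obtain ⟨B, hB₁, hB₂, hB₃, hB₄⟩ := hB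
    have hsB : s B = 0 := by
      have := hs B
      rw [show (F'.N (B + 1)).colonElem a₁ = F'.N B from hn₁ B hB₃,
        Submodule.relLength_eq_zero le_rfl] at this
      exact_mod_cast this.symm
    rw [hS₁' B hB₂, hS₂', ENat.tsum_pnat_eq_sum_range fun n hn => hT' n (hB₄.trans hn.le),
      ← Nat.cast_add]
    refine EReal.intCast_le_natCast_ennreal ?_
    have hsum := Ideal.Filtration.sum_succ_mul_sub (fun n => (s n : ℤ) - t n) B
    -- Summation by parts produces `t 0 + ⋯ + t (B-1)`, whereas the second sum starts at index one;
    -- `t 0 = 0` reconciles them.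
    have htsum : ∑ n ∈ Finset.range B, t n ≤ ∑ n ∈ Finset.range B, t (n + 1) := by
      have h1 := Finset.sum_range_succ t B
      rw [Finset.sum_range_succ', ht0] at h1
      lia
    have htsum' : ∑ n ∈ Finset.range B, (t n : ℤ) ≤ ∑ n ∈ Finset.range B, (t (n + 1) : ℤ) := by
      exact_mod_cast htsum
    have hssum : 0 ≤ ∑ n ∈ Finset.range B, (s n : ℤ) :=
      Finset.sum_nonneg fun n _ => Int.natCast_nonneg _
    rw [hsB, hT' B hB₄, Finset.sum_sub_distrib] at hsum
    calc F.hilbertCoeff 2 - N.hilbertCoeff 2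
        ≤ ∑ n ∈ Finset.range B, ((n : ℤ) + 1) *
          (v (n + 1) + (s (n + 1) - s n) - (t (n + 1) - t n)) := by
          rw [he₂ B hB₁]
          exact Finset.sum_le_sum fun n _ => mul_le_mul_of_nonneg_left (hst n) (by positivity)
      _ = ∑ n ∈ Finset.range B, (((n : ℤ) + 1) * v (n + 1)) +
          ∑ n ∈ Finset.range B, ((n : ℤ) + 1) *
            (((s (n + 1) : ℤ) - t (n + 1)) - (s n - t n)) := by
          rw [← Finset.sum_add_distrib]
          exact Finset.sum_congr rfl fun n _ => by ring
      _ ≤ _ := by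
          rw [hsum]
          push_cast
          linarith
  · obtain ⟨T', hT'⟩ := hNs.isSuperficial_fst.exists_colonElem_eq hNgood hreg
    rw [hS₂', ENat.tsum_pnat_eq_sum_range (T := T') fun n hn => ?_]
    · exact ENat.natCast_ne_top _
    · have := ht n
      rw [hT' n hn.le, Submodule.relLength_eq_zero le_rfl] at this
      exact_mod_cast this.symm
  · exact hS₂.trans ((tsum_congr fun n : ℕ+ => Submodule.relLength_eq_zero
      (hNs.isSuperficial_fst.colonElem_le_of_grDepth_pos hNgood.1 hgr hk (n : ℕ))).trans tsum_zero)
  · have hB : ∃ B, T ≤ B ∧ n₀ ≤ B := ⟨T + n₀, by lia⟩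
    obtain ⟨B, hB₁, hB₂⟩ := hB
    rw [hS₁' B hB₂]
    refine EReal.intCast_le_natCast_ennreal ?_
    rw [he₂ B hB₁]
    push_cast
    exact Finset.sum_le_sum fun n _ => mul_le_mul_of_nonneg_left
      (Ideal.Filtration.hilbertFunction_sub_le hk hF'.1 hNgood.1 hNF
        (Ideal.Filtration.colonElem_inf_le_of_grDepth_pos hNgood.1 hgr hk) hv n) (by positivity)
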